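/- Let $n\ge 1$ and let $\Omega\subset\mathbb R^n$ be a bounded Lipschitz open set, i.e. each point of $\partial\Omega$ has a neighbourhood in which, in a suitable orthonormal frame, $\Omega$ is the set of points lying strictly on one side of the graph of a Lipschitz function. Let $\mathcal H^{n-1}$ be the $(n-1)$-dimensional Hausdorff measure and, for $1\le p<\infty$, write $L^p(\partial\Omega)=L^p(\partial\Omega,\mathcal H^{n-1})$. A function $g\in L^p(\partial\Omega)$ is called a trace of $u\in W^{1,p}(\Omega)$ if there are $\varphi_k\in C^\infty(\mathbb R^n)$ with $\varphi_k\to u$ in $W^{1,p}(\Omega)$ and $\varphi_k|_{\partial\Omega}\to g$ in $L^p(\partial\Omega)$. Then: 1. For every $1\le p<\infty$, every $u\in W^{1,p}(\Omega)$ has a trace, unique up to $\mathcal H^{n-1}$-null sets, denoted $\operatorname{tr}u$. If $u\in W^{1,p}(\Omega)\cap C^0(\overline\Omega)$, then $\operatorname{tr}u=u$ $\mathcal H^{n-1}$-a.e. on $\partial\Omega$. 2. $W^{1,1}_0(\Omega)=\{u\in W^{1,1}(\Omega):\operatorname{tr}u=0\}$, where $W^{1,1}_0(\Omega)$ is the closure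 of $C_c^\infty(\Omega)$ in $W^{1,1}(\Omega)$. -/

import Mathlib

open MeasureTheory Filter Topology
open scoped ENNReal NNReal ContDiff RealInnerProductSpace

namespace SobolevTrace

/-- The Euclidean space of dimension `n`. -/
abbrev E (n : ℕ) : Type := EuclideanSpace ℝ (Fin n)

variable {n : ℕ}

/-- A bounded Lipschitz open set (not necessarily connected): near each boundary point, after a
choice of a unit direction `e`, the set is the strict subgraph, in the direction `e`, of a Lipschitz
function `γ` defined on the hyperplane orthogonal to `e`. -/
def IsLipschitzDomain (Ω : Set (E n)) : Prop :=
  IsOpen Ω ∧ Bornology.IsBounded Ω ∧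
    ∀ x₀ ∈ frontier Ω, ∃ e : E n, ‖e‖ = 1 ∧
      ∃ (K : ℝ≥0) (γ : (ℝ ∙ e)ᗮ → ℝ), LipschitzWith K γ ∧
        ∃ U ∈ 𝓝 x₀, ∀ x ∈ U, x ∈ Ω ↔ ⟪e, x⟫ < γ ((ℝ ∙ e)ᗮ.orthogonalProjectionOnto x)

/-- The surface measure on the boundary: the `(n-1)`-dimensional Hausdorff measure (for the Euclidean
distance) restricted to `∂Ω`. -/
noncomputable def surfaceMeasure (Ω : Set (E n)) : Measure (E n) :=
  (Measure.hausdorffMeasure ((n : ℝ) - 1)).restrict (frontier Ω)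

/-- `φ ∈ C_c^∞(Ω)`. -/
def IsTestFunction (Ω : Set (E n)) (φ : E n → ℝ) : Prop :=
  ContDiff ℝ ∞ φ ∧ HasCompactSupport φ ∧ tsupport φ ⊆ Ω

/-- `G` is the distributional gradient of `u` in `Ω`, tested against `C_c^∞(Ω)`. It is used only
for `u` and `G` in some `L^p(Ω)`, so that all the integrals converge. -/
def IsWeakGradient (Ω : Set (E n)) (u : E n → ℝ) (G : E n → E n) : Prop :=
  ∀ φ : E n → ℝ, IsTestFunction Ω φ → ∀ v : E n,
    ∫ x in Ω, u x * fderiv ℝ φ x v = - ∫ x in Ω, ⟪G x, v⟫ * φ x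

/-- `u ∈ W^{1,p}(Ω)`; only the values of `u` in `Ω` matter, up to null sets. -/
def MemW1 (Ω : Set (E n)) (p : ℝ≥0∞) (u : E n → ℝ) : Prop :=
  MemLp u p (volume.restrict Ω) ∧
    ∃ G : E n → E n, MemLp G p (volume.restrict Ω) ∧ IsWeakGradient Ω u G

/-- The smooth functions `φ k` converge to `u ∈ W^{1,p}(Ω)` in the norm of `W^{1,p}(Ω)`. -/
def SmoothTendstoW1 (Ω : Set (E n)) (p : ℝ≥0∞) (φ : ℕ → E n → ℝ) (u : E n → ℝ) : Prop :=
  (∀ k, ContDiff ℝ ∞ (φ k)) ∧ MemLp u p (volume.restrict Ω) ∧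
    ∃ G : E n → E n, MemLp G p (volume.restrict Ω) ∧ IsWeakGradient Ω u G ∧
      Tendsto (fun k => eLpNorm (fun x => φ k x - u x) p (volume.restrict Ω)) atTop (𝓝 0) ∧
      Tendsto (fun k => eLpNorm (fun x => gradient (φ k) x - G x) p (volume.restrict Ω))
        atTop (𝓝 0)

/-- `u ∈ W^{1,p}_0(Ω)`: the closure of `C_c^∞(Ω)` in `W^{1,p}(Ω)`. -/
def MemW1Zero (Ω : Set (E n)) (p : ℝ≥0∞) (u : E n → ℝ) : Prop :=
  ∃ φ : ℕ → E n → ℝ, (∀ k, IsTestFunction Ω (φ k)) ∧ SmoothTendstoW1 Ω p φ u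

/-- `g ∈ L^p(∂Ω)` is the trace of `u ∈ W^{1,p}(Ω)`: the limit in `L^p(∂Ω)` of the boundary values of
functions in `C^∞(ℝⁿ)` that converge to `u` in `W^{1,p}(Ω)`. -/
def IsTrace (Ω : Set (E n)) (p : ℝ≥0∞) (u g : E n → ℝ) : Prop :=
  MemLp g p (surfaceMeasure Ω) ∧
    ∃ φ : ℕ → E n → ℝ, SmoothTendstoW1 Ω p φ u ∧
      Tendsto (fun k => eLpNorm (fun x => φ k x - g x) p (surfaceMeasure Ω)) atTop (𝓝 0)

end SobolevTrace

/-!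
Mollifying with kernels supported in small balls shifted along the graph direction uses only values
of `u` in `Ω`, so on a neighbourhood of each boundary point `u` and its weak gradient are limits of
smooth functions; a partition of unity makes these approximations global. Integrating along lines
transversal to the graph bounds `‖φ‖` in `L^p(∂Ω)` by the `W^{1,p}(Ω)` norm of a smooth `φ`. Hence
the boundary values of an approximating sequence are Cauchy in `L^p(∂Ω)`, and their limit does not
depend on the sequence.

For the last part, integration along the same lines over the layer of width `δ` gives
`∫_{layer δ} |φ| ≤ C δ (∫_{∂Ω} |φ| + ∫_{layer M δ} |∇φ|)`. If `tr u = 0`, the factor `δ` compensates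
the gradient of size `1 / δ` of a cutoff `χ` vanishing near `∂Ω`, so `χ u` is close to `u` in
`W^{1,1}(Ω)`.
-/

namespace SobolevTrace

open scoped Convolution

variable {n : ℕ}

/-! ### Mollification -/

section Mollifier

variable {V : Type*} [NormedAddCommGroup V] [MeasurableSpace V] [BorelSpace V]

theorem tendsto_eLpNorm_translate_sub (μ : Measure V) [IsLocallyFiniteMeasure μ]
    [μ.InnerRegularCompactLTTop] [μ.IsAddRightInvariant] {F : Type*} [NormedAddCommGroup F]
    {f : V → F} {p : ℝ≥0∞} (hp : 1 ≤ p) (hp' : p ≠ ⊤) (hf : MemLp f p μ) :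
    Tendsto (fun y => eLpNorm (fun x => f (x - y) - f x) p μ) (𝓝 0) (𝓝 0) := by
  have : Fact (1 ≤ p) := ⟨hp⟩
  have hshift (y : V) : MeasurePreserving (fun x => x - y) μ μ := measurePreserving_sub_right μ y
  let shift : V → C(V, V) := fun y => ⟨fun x => x - y, by fun_prop⟩
  have hcont : Continuous shift :=
    ContinuousMap.continuous_of_continuous_uncurry _ (continuous_snd.sub continuous_fst)
  have hlim :=
    ((continuous_const (y := hf.toLp f)).compMeasurePreservingLp hcont hshift hp').tendsto 0
  rw [tendsto_iff_edist_tendsto_0] at hlim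
  refine hlim.congr fun y => ?_
  rw [Lp.edist_def]
  have hcoe (z : V) : Lp.compMeasurePreserving (fun x => x - z) (hshift z) (hf.toLp f) =ᵐ[μ]
      fun x => f (x - z) :=
    (Lp.coeFn_compMeasurePreserving _ _).trans
      ((hshift z).quasiMeasurePreserving.ae_eq hf.coeFn_toLp)
  exact eLpNorm_congr_ae <| (hcoe y).sub <| (hcoe 0).trans (.of_eq (by simp))

theorem lintegral_rpow_le_of_isProbabilityMeasure {α : Type*} [MeasurableSpace α] (ν : Measure α)
    [IsProbabilityMeasure ν] {p : ℝ} (hp : 1 ≤ p) {f : α → ℝ≥0∞} (hf : AEMeasurable f ν) :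
    (∫⁻ a, f a ∂ν) ^ p ≤ ∫⁻ a, f a ^ p ∂ν := by
  have h := eLpNorm'_le_eLpNorm'_of_exponent_le one_pos hp ν hf.aestronglyMeasurable
  simp only [eLpNorm', enorm_eq_self, ENNReal.rpow_one, div_one] at h
  rwa [one_div, ENNReal.le_rpow_inv_iff (zero_lt_one.trans_le hp)] at h

variable [NormedSpace ℝ V]

/-- A smooth, compactly supported probability density with respect to `μ`. -/
structure IsMollifier (μ : Measure V) (k : V → ℝ) : Prop where
  contDiff : ContDiff ℝ ∞ k
  hasCompactSupport : HasCompactSupport k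
  nonneg : ∀ x, 0 ≤ k x
  integral_eq_one : ∫ x, k x ∂μ = 1

theorem exists_isMollifier [FiniteDimensional ℝ V] (μ : Measure V) [IsLocallyFiniteMeasure μ]
    [μ.IsOpenPosMeasure] (c : V) {ε : ℝ} (hε : 0 < ε) :
    ∃ k : V → ℝ, IsMollifier μ k ∧ Function.support k ⊆ Metric.ball c ε := by
  let φ : ContDiffBump c := ⟨ε / 2, ε, half_pos hε, half_lt_self hε⟩
  exact ⟨φ.normed μ, ⟨φ.contDiff_normed, φ.hasCompactSupport_normed, φ.nonneg_normed,
    φ.integral_normed⟩, φ.support_normed_eq.subset⟩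

/-- The convolution `k ⋆ f` of `f` with the scalar kernel `k`. -/
noncomputable def mollify (μ : Measure V) {F : Type*} [NormedAddCommGroup F] [NormedSpace ℝ F]
    (k : V → ℝ) (f : V → F) : V → F :=
  k ⋆[ContinuousLinearMap.lsmul ℝ ℝ, μ] f

variable {μ : Measure V} {F : Type*} [NormedAddCommGroup F] [NormedSpace ℝ F] {k : V → ℝ}
  {f : V → F}

namespace IsMollifier

theorem contDiff_mollify (hk : IsMollifier μ k) (hf : LocallyIntegrable f μ) [μ.IsAddLeftInvariant]
    [μ.IsNegInvariant] : ContDiff ℝ ∞ (mollify μ k f) :=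
  hk.hasCompactSupport.contDiff_convolution_left _ hk.contDiff hf

theorem integrable_smul (hk : IsMollifier μ k) [μ.IsAddLeftInvariant] [μ.IsNegInvariant]
    (hf : LocallyIntegrable f μ) (x : V) : Integrable (fun y => k y • f (x - y)) μ :=
  hk.hasCompactSupport.convolutionExists_left (ContinuousLinearMap.lsmul ℝ ℝ)
    hk.contDiff.continuous hf x

theorem integrable [IsFiniteMeasureOnCompacts μ] (hk : IsMollifier μ k) : Integrable k μ :=
  hk.contDiff.continuous.integrable_of_hasCompactSupport hk.hasCompactSupport

theorem lintegral_ofReal_eq_one [IsFiniteMeasureOnCompacts μ] (hk : IsMollifier μ k) :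
    ∫⁻ x, ENNReal.ofReal (k x) ∂μ = 1 := by
  rw [← ofReal_integral_eq_lintegral_ofReal hk.integrable (.of_forall hk.nonneg),
    hk.integral_eq_one, ENNReal.ofReal_one]

theorem norm_integral_smul_le [IsFiniteMeasureOnCompacts μ] (hk : IsMollifier μ k) {g : V → F}
    {C : ℝ} (hg : ∀ y ∈ Function.support k, ‖g y‖ ≤ C) : ‖∫ y, k y • g y ∂μ‖ ≤ C := by
  calc ‖∫ y, k y • g y ∂μ‖ ≤ ∫ y, k y * C ∂μ := by
        refine norm_integral_le_of_norm_le (hk.integrable.mul_const C) (.of_forall fun y => ?_)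
        rw [norm_smul, Real.norm_of_nonneg (hk.nonneg y)]
        by_cases hy : k y = 0
        · simp [hy]
        · exact mul_le_mul_of_nonneg_left (hg y hy) (hk.nonneg y)
    _ = C := by rw [integral_mul_const, hk.integral_eq_one, one_mul]

variable [μ.IsAddHaarMeasure] [FiniteDimensional ℝ V]

theorem mollify_sub_mollify (hk : IsMollifier μ k) (hf : LocallyIntegrable f μ) (x z : V) :
    mollify μ k f x - mollify μ k f z = ∫ y, k y • (f (x - y) - f (z - y)) ∂μ := by
  simp_rw [mollify, convolution_lsmul, smul_sub]
  rw [integral_sub (hk.integrable_smul hf x) (hk.integrable_smul hf z)]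

theorem lipschitzWith_mollify (hk : IsMollifier μ k) {K : ℝ≥0} (hf : LipschitzWith K f) :
    LipschitzWith K (mollify μ k f) := by
  refine LipschitzWith.of_dist_le_mul fun x z => ?_
  rw [dist_eq_norm, hk.mollify_sub_mollify hf.continuous.locallyIntegrable]
  refine hk.norm_integral_smul_le fun y _ => ?_
  simpa [dist_eq_norm] using hf.dist_le_mul (x - y) (z - y)

variable [CompleteSpace F]

theorem mollify_sub (hk : IsMollifier μ k) (hf : LocallyIntegrable f μ) (x : V) (c : F) :
    mollify μ k f x - c = ∫ y, k y • (f (x - y) - c) ∂μ := by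
  simp_rw [smul_sub]
  rw [integral_sub (hk.integrable_smul hf x) (hk.integrable.smul_const c), integral_smul_const,
    hk.integral_eq_one, one_smul, mollify, convolution_lsmul]

theorem norm_mollify_sub_le (hk : IsMollifier μ k) (hf : LocallyIntegrable f μ) {x : V} {c : F}
    {δ : ℝ} (h : ∀ y ∈ Function.support k, ‖f (x - y) - c‖ ≤ δ) : ‖mollify μ k f x - c‖ ≤ δ := by
  rw [hk.mollify_sub hf]
  exact hk.norm_integral_smul_le h

theorem mollify_eq_of_forall_support (hk : IsMollifier μ k) (hf : LocallyIntegrable f μ) {x : V}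
    {c : F} (h : ∀ y ∈ Function.support k, f (x - y) = c) : mollify μ k f x = c := by
  rw [← sub_eq_zero, ← norm_le_zero_iff]
  exact hk.norm_mollify_sub_le hf fun y hy => by simp [h y hy]

theorem enorm_mollify_sub_rpow_le (hk : IsMollifier μ k) (hf : LocallyIntegrable f μ)
    (hfm : StronglyMeasurable f) {p : ℝ} (hp : 1 ≤ p) (x : V) (c : F) :
    ‖mollify μ k f x - c‖ₑ ^ p ≤ ∫⁻ y, ENNReal.ofReal (k y) * ‖f (x - y) - c‖ₑ ^ p ∂μ := by
  have hkm : Measurable fun y => ENNReal.ofReal (k y) :=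
    hk.contDiff.continuous.measurable.ennreal_ofReal
  let ν : Measure V := μ.withDensity fun y => ENNReal.ofReal (k y)
  have : IsProbabilityMeasure ν := ⟨by
    rw [withDensity_apply _ MeasurableSet.univ, setLIntegral_univ, hk.lintegral_ofReal_eq_one]⟩
  have hm : Measurable fun y => ‖f (x - y) - c‖ₑ :=
    ((hfm.comp_measurable (measurable_const.sub measurable_id)).sub stronglyMeasurable_const).enorm
  calc ‖mollify μ k f x - c‖ₑ ^ p
      ≤ (∫⁻ y, ‖k y • (f (x - y) - c)‖ₑ ∂μ) ^ p := by
        rw [hk.mollify_sub hf]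
        gcongr
        exact enorm_integral_le_lintegral_enorm _
    _ = (∫⁻ y, ‖f (x - y) - c‖ₑ ∂ν) ^ p := by
        rw [lintegral_withDensity_eq_lintegral_mul _ hkm hm]
        simp [enorm_smul, Real.enorm_of_nonneg (hk.nonneg _)]
    _ ≤ ∫⁻ y, ‖f (x - y) - c‖ₑ ^ p ∂ν :=
        lintegral_rpow_le_of_isProbabilityMeasure ν hp hm.aemeasurable
    _ = ∫⁻ y, ENNReal.ofReal (k y) * ‖f (x - y) - c‖ₑ ^ p ∂μ :=
        lintegral_withDensity_eq_lintegral_mul _ hkm (hm.pow_const p)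

theorem lintegral_enorm_mollify_sub_rpow_le (hk : IsMollifier μ k) (hf : LocallyIntegrable f μ)
    (hfm : StronglyMeasurable f) {p : ℝ} (hp : 1 ≤ p) {C : ℝ≥0∞}
    (h : ∀ y ∈ Function.support k, ∫⁻ x, ‖f (x - y) - f x‖ₑ ^ p ∂μ ≤ C) :
    ∫⁻ x, ‖mollify μ k f x - f x‖ₑ ^ p ∂μ ≤ C := by
  have hkm : Measurable fun y => ENNReal.ofReal (k y) :=
    hk.contDiff.continuous.measurable.ennreal_ofReal
  calc ∫⁻ x, ‖mollify μ k f x - f x‖ₑ ^ p ∂μ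
      ≤ ∫⁻ x, ∫⁻ y, ENNReal.ofReal (k y) * ‖f (x - y) - f x‖ₑ ^ p ∂μ ∂μ :=
        lintegral_mono fun x => hk.enorm_mollify_sub_rpow_le hf hfm hp x _
    _ = ∫⁻ y, ∫⁻ x, ENNReal.ofReal (k y) * ‖f (x - y) - f x‖ₑ ^ p ∂μ ∂μ := by
        refine lintegral_lintegral_swap (Measurable.aemeasurable ?_)
        refine (hkm.comp measurable_snd).mul (Measurable.pow_const ?_ _)
        exact ((hfm.comp_measurable (measurable_fst.sub measurable_snd)).sub
          (hfm.comp_measurable measurable_fst)).enorm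
    _ ≤ ∫⁻ y, ENNReal.ofReal (k y) * C ∂μ := by
        refine lintegral_mono fun y => ?_
        rw [lintegral_const_mul' _ _ ENNReal.ofReal_ne_top]
        by_cases hy : k y = 0
        · simp [hy]
        · exact mul_le_mul_right (h y hy) _
    _ = C := by rw [lintegral_mul_const _ hkm, hk.lintegral_ofReal_eq_one, one_mul]

theorem eLpNorm_mollify_sub_le (hk : IsMollifier μ k) {p : ℝ≥0∞} (hp : 1 ≤ p) (hp' : p ≠ ⊤)
    (hf : MemLp f p μ) {δ : ℝ≥0∞}
    (h : ∀ y ∈ Function.support k, eLpNorm (fun x => f (x - y) - f x) p μ ≤ δ) :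
    eLpNorm (fun x => mollify μ k f x - f x) p μ ≤ δ := by
  wlog hfm : StronglyMeasurable f generalizing f
  · have hae := hf.1.ae_eq_mk
    have hmollify : mollify μ k f = mollify μ k (hf.1.mk f) :=
      convolution_congr _ (ae_eq_refl k) hae
    have hshift (y : V) : (fun x => f (x - y)) =ᵐ[μ] fun x => hf.1.mk f (x - y) :=
      (measurePreserving_sub_right μ y).quasiMeasurePreserving.ae_eq hae
    rw [hmollify]
    refine (eLpNorm_congr_ae ((ae_eq_refl _).sub hae)).trans_le ?_
    refine this (hf.ae_eq hae) (fun y hy => ?_) hf.1.stronglyMeasurable_mk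
    exact (eLpNorm_congr_ae ((hshift y).sub hae)).symm.trans_le (h y hy)
  have hp0 : p ≠ 0 := (zero_lt_one.trans_le hp).ne'
  have hpr : 1 ≤ p.toReal := by simpa using ENNReal.toReal_mono hp' hp
  have hiff (g : V → F) : eLpNorm g p μ ≤ δ ↔ ∫⁻ x, ‖g x‖ₑ ^ p.toReal ∂μ ≤ δ ^ p.toReal := by
    rw [eLpNorm_eq_lintegral_rpow_enorm_toReal hp0 hp', one_div,
      ENNReal.rpow_inv_le_iff (zero_lt_one.trans_le hpr)]
  rw [hiff]
  exact hk.lintegral_enorm_mollify_sub_rpow_le (hf.locallyIntegrable hp) hfm hpr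
    fun y hy => (hiff _).1 (h y hy)

end IsMollifier

theorem tendsto_eLpNorm_mollify_sub [FiniteDimensional ℝ V] [μ.IsAddHaarMeasure] [CompleteSpace F]
    {p : ℝ≥0∞} (hp : 1 ≤ p) (hp' : p ≠ ⊤) (hf : MemLp f p μ) {k : ℕ → V → ℝ}
    (hk : ∀ m, IsMollifier μ (k m)) {r : ℕ → ℝ} (hr : Tendsto r atTop (𝓝 0))
    (hsupp : ∀ m, Function.support (k m) ⊆ Metric.ball 0 (r m)) :
    Tendsto (fun m => eLpNorm (fun x => mollify μ (k m) f x - f x) p μ) atTop (𝓝 0) := by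
  rw [ENNReal.tendsto_nhds_zero]
  intro δ hδ
  obtain ⟨ε, hε, hball⟩ := Metric.mem_nhds_iff.1 <|
    (tendsto_eLpNorm_translate_sub μ hp hp' hf).eventually (Iic_mem_nhds hδ)
  filter_upwards [hr.eventually (Iio_mem_nhds hε)] with m hm
  exact (hk m).eLpNorm_mollify_sub_le hp hp' hf fun y hy =>
    hball (Metric.ball_subset_ball hm.le (hsupp m hy))

theorem tendsto_eLpNorm_mollify_indicator_sub [FiniteDimensional ℝ V] [μ.IsAddHaarMeasure]
    [CompleteSpace F] {p : ℝ≥0∞} (hp : 1 ≤ p) (hp' : p ≠ ⊤) {s : Set V} (hs : MeasurableSet s)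
    (hf : MemLp f p (μ.restrict s)) {k : ℕ → V → ℝ} (hk : ∀ m, IsMollifier μ (k m)) {r : ℕ → ℝ}
    (hr : Tendsto r atTop (𝓝 0)) (hsupp : ∀ m, Function.support (k m) ⊆ Metric.ball 0 (r m)) :
    Tendsto (fun m => eLpNorm (fun x => mollify μ (k m) (s.indicator f) x - f x) p (μ.restrict s))
      atTop (𝓝 0) := by
  have hind : MemLp (s.indicator f) p μ := (memLp_indicator_iff_restrict hs).2 hf
  refine tendsto_of_tendsto_of_tendsto_of_le_of_le tendsto_const_nhds
    (tendsto_eLpNorm_mollify_sub hp hp' hind hk hr hsupp) (fun _ => zero_le) fun m => ?_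
  refine (eLpNorm_congr_ae ?_).trans_le (eLpNorm_mono_measure _ Measure.restrict_le_self)
  filter_upwards [ae_restrict_mem hs] with x hx
  rw [Set.indicator_of_mem hx]

theorem tendstoUniformlyOn_mollify_indicator [FiniteDimensional ℝ V] [μ.IsAddHaarMeasure]
    [CompleteSpace F] {A s : Set V} (hf : LocallyIntegrable (s.indicator f) μ)
    (hcont : UniformContinuousOn f (A ∪ s)) {k : ℕ → V → ℝ} (hk : ∀ m, IsMollifier μ (k m))
    {r : ℕ → ℝ} (hr : Tendsto r atTop (𝓝 0))
    (hsupp : ∀ m, Function.support (k m) ⊆ Metric.ball 0 (r m))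
    (hmem : ∀ m, ∀ x ∈ A, ∀ y ∈ Function.support (k m), x - y ∈ s) :
    TendstoUniformlyOn (fun m => mollify μ (k m) (s.indicator f)) f atTop A := by
  rw [Metric.tendstoUniformlyOn_iff]
  intro δ hδ
  obtain ⟨ε, hε, hclose⟩ := Metric.uniformContinuousOn_iff.1 hcont (δ / 2) (half_pos hδ)
  filter_upwards [hr.eventually (Iio_mem_nhds hε)] with m hm x hx
  have hle : ‖mollify μ (k m) (s.indicator f) x - f x‖ ≤ δ / 2 := by
    refine (hk m).norm_mollify_sub_le hf fun y hy => ?_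
    have hys : x - y ∈ s := hmem m x hx y hy
    have hyε : ‖y‖ < ε := (mem_ball_zero_iff.1 (hsupp m hy)).trans hm
    rw [Set.indicator_of_mem hys, ← dist_eq_norm]
    exact (hclose _ (.inr hys) x (.inl hx) (by simpa using hyε)).le
  rw [dist_comm, dist_eq_norm]
  exact hle.trans_lt (half_lt_self hδ)

end Mollifier

theorem exists_smooth_cutoff {V : Type*} [NormedAddCommGroup V] [NormedSpace ℝ V]
    [FiniteDimensional ℝ V] (A : Set V) {δ : ℝ} (hδ : 0 < δ) :
    ∃ χ : V → ℝ, ContDiff ℝ ∞ χ ∧ (∀ x, χ x ∈ Set.Icc 0 1) ∧ (∀ x, ‖fderiv ℝ χ x‖ ≤ 4 / δ) ∧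
      (∀ x ∈ Metric.thickening (δ / 4) A, χ x = 0) ∧ ∀ x ∉ Metric.thickening δ A, χ x = 1 := by
  let : MeasurableSpace V := borel V
  have : BorelSpace V := ⟨rfl⟩
  let μ : Measure V := Measure.addHaar
  have hδ4 : 0 < δ / 4 := by positivity
  let ψ : V → ℝ≥0 := thickenedIndicator hδ4 (Metric.thickening (δ / 2) A)
  let f : V → ℝ := fun x => 1 - ψ x
  have hψ (x : V) : ψ x ≤ 1 := thickenedIndicator_le_one hδ4 _ x
  have hf : LipschitzWith (δ / 4).toNNReal⁻¹ f := fun x y => by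
    rw [edist_sub_left]
    exact lipschitzWith_thickenedIndicator hδ4 _ x y
  have hloc : LocallyIntegrable f μ := hf.continuous.locallyIntegrable
  obtain ⟨k, hk, hsupp⟩ := exists_isMollifier μ (0 : V) hδ4
  have hdist {x y : V} (hy : y ∈ Function.support k) : dist x (x - y) < δ / 4 := by
    simpa [dist_eq_norm] using hsupp hy
  refine ⟨mollify μ k f, hk.contDiff_mollify hloc, fun x => ?_, fun x => ?_, fun x hx => ?_,
    fun x hx => ?_⟩
  · have hhalf : ‖mollify μ k f x - 1 / 2‖ ≤ 1 / 2 := hk.norm_mollify_sub_le hloc fun y _ => by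
      rw [Real.norm_eq_abs, abs_le]
      have : (ψ (x - y) : ℝ) ≤ 1 := hψ _
      constructor <;> linarith [(ψ (x - y)).coe_nonneg]
    rw [Real.norm_eq_abs, abs_le] at hhalf
    constructor <;> linarith
  · refine (norm_fderiv_le_of_lipschitz ℝ (hk.lipschitzWith_mollify hf)).trans_eq ?_
    rw [NNReal.coe_inv, Real.coe_toNNReal _ hδ4.le, inv_div]
  · refine hk.mollify_eq_of_forall_support hloc fun y hy => ?_
    obtain ⟨z, hz, hxz⟩ := Metric.mem_thickening_iff.1 hx
    have hmem : x - y ∈ Metric.thickening (δ / 2) A := Metric.mem_thickening_iff.2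
      ⟨z, hz, by linarith [dist_triangle (x - y) x z, dist_comm x (x - y), hdist (x := x) hy]⟩
    simp only [f, ψ, thickenedIndicator_one hδ4 _ hmem, NNReal.coe_one, sub_self]
  · refine hk.mollify_eq_of_forall_support hloc fun y hy => ?_
    have hnot : x - y ∉ Metric.thickening (δ / 4) (Metric.thickening (δ / 2) A) := fun hmem => by
      obtain ⟨z, hz, hyz⟩ := Metric.mem_thickening_iff.1 hmem
      obtain ⟨a, ha, hza⟩ := Metric.mem_thickening_iff.1 hz
      refine hx (Metric.mem_thickening_iff.2 ⟨a, ha, ?_⟩)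
      linarith [dist_triangle4 x (x - y) z a, hdist (x := x) hy]
    simp only [f, ψ, thickenedIndicator_zero hδ4 _ hnot, NNReal.coe_zero, sub_zero]

/-! ### Graph charts -/

/-- Near `x₀`, the set `Ω` is `{h > 0}`, where `h` is Lipschitz and decreases with unit speed in the
unit direction `e`: it is the height of the graph above a point, so that `∂Ω` is `{h = 0}`. -/
structure IsGraphChart {V : Type*} [NormedAddCommGroup V] [NormedSpace ℝ V] (Ω : Set V)
    (x₀ e : V) (L : ℝ≥0) (h : V → ℝ) (R : ℝ) : Prop where
  norm_eq_one : ‖e‖ = 1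
  lipschitz : LipschitzWith L h
  map_add_smul : ∀ x t, h (x + t • e) = h x - t
  radius_pos : 0 < R
  mem_iff : ∀ x ∈ Metric.ball x₀ R, x ∈ Ω ↔ 0 < h x

namespace IsGraphChart

variable {V : Type*} [NormedAddCommGroup V] [NormedSpace ℝ V] {Ω : Set V} {x₀ e : V} {L : ℝ≥0}
  {h : V → ℝ} {R : ℝ}

theorem map_sub_smul (hc : IsGraphChart Ω x₀ e L h R) (x : V) (t : ℝ) :
    h (x - t • e) = h x + t := by
  rw [sub_eq_add_neg, ← neg_smul, hc.map_add_smul, sub_neg_eq_add]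

theorem dist_sub_smul (hc : IsGraphChart Ω x₀ e L h R) (x : V) {t : ℝ} (ht : 0 ≤ t) :
    dist (x - t • e) x = t := by
  rw [dist_eq_norm, sub_sub_cancel_left, norm_neg, norm_smul, hc.norm_eq_one, mul_one,
    Real.norm_of_nonneg ht]

theorem map_sub_mul_dist_le (hc : IsGraphChart Ω x₀ e L h R) (x y : V) :
    h x - L * dist x y ≤ h y := by
  linarith [(abs_le.1 (hc.lipschitz.dist_le_mul x y)).2]

theorem nonneg_of_mem_closure (hc : IsGraphChart Ω x₀ e L h R) {x : V}
    (hx : x ∈ Metric.ball x₀ R) (hxΩ : x ∈ closure Ω) : 0 ≤ h x :=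
  closure_minimal (fun y hy => ((hc.mem_iff y hy.1).1 hy.2).le)
    (isClosed_le continuous_const hc.lipschitz.continuous)
    (Metric.isOpen_ball.inter_closure ⟨hx, hxΩ⟩)

theorem eq_zero_of_mem_frontier (hc : IsGraphChart Ω x₀ e L h R) (hΩ : IsOpen Ω) {x : V}
    (hx : x ∈ Metric.ball x₀ R) (hxΩ : x ∈ frontier Ω) : h x = 0 := by
  rw [hΩ.frontier_eq] at hxΩ
  refine le_antisymm ?_ (hc.nonneg_of_mem_closure hx hxΩ.1)
  by_contra! hpos
  exact hxΩ.2 ((hc.mem_iff x hx).2 hpos)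

theorem sub_smul_mem (hc : IsGraphChart Ω x₀ e L h R) {y : V} (hy : h y = 0) {t : ℝ} (ht : 0 < t)
    (htR : dist y x₀ + t < R) : y - t • e ∈ Ω := by
  have hball : y - t • e ∈ Metric.ball x₀ R := by
    rw [Metric.mem_ball]
    linarith [dist_triangle (y - t • e) y x₀, hc.dist_sub_smul y ht.le]
  rwa [hc.mem_iff _ hball, hc.map_sub_smul, hy, zero_add]

theorem closedBall_sub_smul_subset (hc : IsGraphChart Ω x₀ e L h R) {x : V} (hx : x ∈ closure Ω)
    {ε : ℝ} (hε : 0 < ε) (hεR : dist x x₀ + ε * (L + 2) < R) :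
    Metric.closedBall (x - ε • (L + 1 : ℝ) • e) ε ⊆ Ω := by
  intro y hy
  rw [Metric.mem_closedBall', smul_smul] at hy
  have hxR : x ∈ Metric.ball x₀ R := by
    have hmargin : 0 ≤ ε * (L + 2) := by positivity
    rw [Metric.mem_ball]
    linarith
  have hshift := hc.dist_sub_smul x (t := ε * (L + 1)) (by positivity)
  have hyR : y ∈ Metric.ball x₀ R := by
    rw [Metric.mem_ball]
    linarith [dist_triangle4 y (x - (ε * (L + 1)) • e) x x₀, dist_comm y (x - (ε * (L + 1)) • e)]
  rw [hc.mem_iff y hyR]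
  calc 0 < h x + ε * (L + 1) - L * ε := by linarith [hc.nonneg_of_mem_closure hxR hx]
    _ ≤ h (x - (ε * (L + 1)) • e) - L * dist (x - (ε * (L + 1)) • e) y := by
        rw [hc.map_sub_smul]
        gcongr
    _ ≤ h y := hc.map_sub_mul_dist_le _ _

end IsGraphChart

namespace IsLipschitzDomain

variable {Ω : Set (E n)}

theorem exists_isGraphChart (hΩ : IsLipschitzDomain Ω) {x₀ : E n} (hx₀ : x₀ ∈ frontier Ω) :
    ∃ (e : E n) (L : ℝ≥0) (h : E n → ℝ) (R : ℝ), IsGraphChart Ω x₀ e L h R := by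
  obtain ⟨e, he, K, γ, hγ, U, hU, hmem⟩ := hΩ.2.2 x₀ hx₀
  obtain ⟨R, hR, hball⟩ := Metric.mem_nhds_iff.1 hU
  have hproj : LipschitzWith (K * 1) fun x => γ ((ℝ ∙ e)ᗮ.orthogonalProjectionOnto x) :=
    hγ.comp (ℝ ∙ e)ᗮ.lipschitzWith_orthogonalProjectionOnto
  have hinner : LipschitzWith 1 fun x => ⟪e, x⟫ := .of_dist_le_mul fun x y => by
    simpa [Real.dist_eq, ← inner_sub_right, dist_eq_norm, he] using
      abs_real_inner_le_norm e (x - y)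
  refine ⟨e, K * 1 + 1, fun x => γ ((ℝ ∙ e)ᗮ.orthogonalProjectionOnto x) - ⟪e, x⟫, R, he,
    hproj.sub hinner, fun x t => ?_, hR, fun x hx => by rw [hmem x (hball hx), sub_pos]⟩
  simp only [map_add, map_smul,
    Submodule.orthogonalProjectionOnto_orthogonalComplement_singleton_eq_zero, smul_zero, add_zero,
    inner_add_right, inner_smul_right, real_inner_self_eq_norm_sq, he]
  ring

theorem exists_inward_direction (hΩ : IsLipschitzDomain Ω) {x₀ : E n} (hx₀ : x₀ ∈ closure Ω) :
    ∃ w : E n, ∃ U : Set (E n), IsOpen U ∧ x₀ ∈ U ∧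
      ∀ᶠ ε : ℝ in 𝓝[>] 0, ∀ x ∈ closure Ω ∩ U, Metric.closedBall (x - ε • w) ε ⊆ Ω := by
  by_cases hmem : x₀ ∈ Ω
  · obtain ⟨r, hr, hball⟩ := Metric.isOpen_iff.1 hΩ.1 x₀ hmem
    refine ⟨0, Metric.ball x₀ (r / 2), Metric.isOpen_ball, Metric.mem_ball_self (half_pos hr), ?_⟩
    filter_upwards [Ioo_mem_nhdsGT (half_pos hr)] with ε hε x hx
    rw [smul_zero, sub_zero]
    refine (Metric.closedBall_subset_ball' ?_).trans hball
    linarith [hε.2, Metric.mem_ball.1 hx.2]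
  · have hfrontier : x₀ ∈ frontier Ω := by
      rw [hΩ.1.frontier_eq]
      exact ⟨hx₀, hmem⟩
    obtain ⟨e, L, h, R, hc⟩ := hΩ.exists_isGraphChart hfrontier
    have hR := hc.radius_pos
    refine ⟨(L + 1 : ℝ) • e, Metric.ball x₀ (R / 2), Metric.isOpen_ball,
      Metric.mem_ball_self (half_pos hR), ?_⟩
    filter_upwards [Ioo_mem_nhdsGT (show 0 < R / 2 / (L + 2) by positivity)] with ε hε x hx
    have hεR := (lt_div_iff₀ (by positivity)).1 hε.2
    exact hc.closedBall_sub_smul_subset hx.1 hε.1 (by linarith [Metric.mem_ball.1 hx.2])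

end IsLipschitzDomain

/-! ### Approximation by smooth functions -/

theorem IsMollifier.fderiv_mollify_apply {V : Type*} [NormedAddCommGroup V] [NormedSpace ℝ V]
    [FiniteDimensional ℝ V] [MeasurableSpace V] [BorelSpace V] {μ : Measure V}
    [μ.IsAddHaarMeasure] {k : V → ℝ} (hk : IsMollifier μ k) {f : V → ℝ}
    (hf : LocallyIntegrable f μ) (x v : V) :
    fderiv ℝ (mollify μ k f) x v = ∫ y, f y * fderiv ℝ k (x - y) v ∂μ := by
  have hk1 : ContDiff ℝ 1 k := hk.contDiff.of_le (by norm_cast)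
  have hint := (hk.hasCompactSupport.fderiv ℝ).convolutionExists_left
    ((ContinuousLinearMap.lsmul ℝ ℝ).precompL V) (hk1.continuous_fderiv one_ne_zero) hf x
  rw [mollify, (hk.hasCompactSupport.hasFDerivAt_convolution_left _ hk1 hf x).fderiv,
    convolution_eq_swap, ContinuousLinearMap.integral_apply hint.integrable_swap]
  simp [ContinuousLinearMap.precompL, mul_comm]

theorem IsMollifier.isTestFunction_comp_sub_left {k : E n → ℝ} (hk : IsMollifier volume k)
    {Ω : Set (E n)} {x : E n} (hx : ∀ y ∈ tsupport k, x - y ∈ Ω) :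
    IsTestFunction Ω fun y => k (x - y) := by
  refine ⟨hk.contDiff.comp (contDiff_const.sub contDiff_id),
    hk.hasCompactSupport.comp_homeomorph (Homeomorph.subLeft x), fun y hy => ?_⟩
  simpa using hx _ (tsupport_comp_subset_preimage k (f := fun y => x - y) (by fun_prop) hy)

theorem IsWeakGradient.gradient_mollify {Ω : Set (E n)} (hΩ : MeasurableSet Ω) {u : E n → ℝ}
    {G : E n → E n} (hG : IsWeakGradient Ω u G) (hu : LocallyIntegrable (Ω.indicator u))
    (hGloc : LocallyIntegrable (Ω.indicator G)) {k : E n → ℝ} (hk : IsMollifier volume k) {x : E n}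
    (hx : ∀ y ∈ tsupport k, x - y ∈ Ω) :
    gradient (mollify volume k (Ω.indicator u)) x = mollify volume k (Ω.indicator G) x := by
  refine ext_inner_right ℝ fun v => ?_
  have hderiv (y : E n) : fderiv ℝ (fun y => k (x - y)) y v = -fderiv ℝ k (x - y) v := by
    have hdiff : DifferentiableAt ℝ k (x - y) := hk.contDiff.differentiable (by simp) _
    have hcomp := hdiff.hasFDerivAt.comp y ((hasFDerivAt_id y).const_sub x)
    rw [show fderiv ℝ (fun y => k (x - y)) y = _ from hcomp.fderiv]
    simp
  have hint : Integrable fun y => k (x - y) • Ω.indicator G y :=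
    ConvolutionExistsAt.integrable_swap (L := ContinuousLinearMap.lsmul ℝ ℝ)
      (hk.hasCompactSupport.convolutionExists_left _ hk.contDiff.continuous hGloc x)
  calc ⟪gradient (mollify volume k (Ω.indicator u)) x, v⟫
      = ∫ y, Ω.indicator u y * fderiv ℝ k (x - y) v := by
        rw [inner_gradient_left, hk.fderiv_mollify_apply hu]
    _ = -∫ y in Ω, u y * fderiv ℝ (fun y => k (x - y)) y v := by
        simp_rw [hderiv, mul_neg, integral_neg, neg_neg]
        rw [← integral_indicator hΩ]
        simp_rw [Set.indicator_mul_left]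
    _ = ∫ y in Ω, ⟪G y, v⟫ * k (x - y) := by
        rw [hG _ (hk.isTestFunction_comp_sub_left hx), neg_neg]
    _ = ∫ y, ⟪v, k (x - y) • Ω.indicator G y⟫ := by
        rw [← integral_indicator hΩ]
        refine integral_congr_ae (.of_forall fun y => ?_)
        by_cases hy : y ∈ Ω <;> simp [hy, inner_smul_right, real_inner_comm, mul_comm]
    _ = ⟪mollify volume k (Ω.indicator G) x, v⟫ := by
        rw [integral_inner hint, real_inner_comm, mollify, convolution_lsmul_swap]

theorem enorm_gradient {V : Type*} [NormedAddCommGroup V] [InnerProductSpace ℝ V]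
    [CompleteSpace V] (f : V → ℝ) (x : V) : ‖gradient f x‖ₑ = ‖fderiv ℝ f x‖ₑ := by
  simp [gradient]

theorem gradient_sub {V : Type*} [NormedAddCommGroup V] [InnerProductSpace ℝ V] [CompleteSpace V]
    {f g : V → ℝ} {x : V} (hf : DifferentiableAt ℝ f x) (hg : DifferentiableAt ℝ g x) :
    gradient (fun y => f y - g y) x = gradient f x - gradient g x := by
  rw [gradient, fderiv_fun_sub hf hg, map_sub, gradient, gradient]

theorem gradient_mul {V : Type*} [NormedAddCommGroup V] [InnerProductSpace ℝ V] [CompleteSpace V]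
    {f g : V → ℝ} {x : V} (hf : DifferentiableAt ℝ f x) (hg : DifferentiableAt ℝ g x) :
    gradient (fun y => f y * g y) x = f x • gradient g x + g x • gradient f x := by
  refine ext_inner_right ℝ fun v => ?_
  simp [fderiv_fun_mul hf hg, inner_add_left, inner_smul_left]

theorem gradient_sum {V ι : Type*} [NormedAddCommGroup V] [InnerProductSpace ℝ V] [CompleteSpace V]
    {s : Finset ι} {f : ι → V → ℝ} {x : V} (hf : ∀ i ∈ s, DifferentiableAt ℝ (f i) x) :
    gradient (fun y => ∑ i ∈ s, f i y) x = ∑ i ∈ s, gradient (f i) x := by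
  refine ext_inner_right ℝ fun v => ?_
  simp [fderiv_fun_sum hf, sum_inner]

theorem continuous_gradient {V : Type*} [NormedAddCommGroup V] [InnerProductSpace ℝ V]
    [CompleteSpace V] {f : V → ℝ} (hf : ContDiff ℝ 1 f) : Continuous (gradient f) :=
  (InnerProductSpace.toDual ℝ V).symm.continuous.comp (hf.continuous_fderiv one_ne_zero)

theorem tendsto_eLpNorm_of_norm_le_mul {α F F' : Type*} [MeasurableSpace α]
    [NormedAddCommGroup F] [NormedAddCommGroup F'] {μ : Measure α} {A U : Set α}
    (hA : MeasurableSet A) (hU : MeasurableSet U) {p : ℝ≥0∞} {f : ℕ → α → F} {g : ℕ → α → F'}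
    {C : ℝ} (hf : Tendsto (fun m => eLpNorm (f m) p (μ.restrict (A ∩ U))) atTop (𝓝 0))
    (hgf : ∀ m, ∀ x ∈ A, ‖g m x‖ ≤ C * ‖f m x‖) (hg : ∀ m, ∀ x ∈ A, x ∉ U → g m x = 0) :
    Tendsto (fun m => eLpNorm (g m) p (μ.restrict A)) atTop (𝓝 0) := by
  have hlim := ENNReal.Tendsto.const_mul (a := ENNReal.ofReal C) hf (.inr ENNReal.ofReal_ne_top)
  rw [mul_zero] at hlim
  refine tendsto_of_tendsto_of_tendsto_of_le_of_le tendsto_const_nhds hlim (fun _ => zero_le)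
    fun m => ?_
  calc eLpNorm (g m) p (μ.restrict A)
      = eLpNorm (U.indicator (g m)) p (μ.restrict A) := by
        refine eLpNorm_congr_ae ?_
        filter_upwards [ae_restrict_mem hA] with x hx
        by_cases hxU : x ∈ U
        · rw [Set.indicator_of_mem hxU]
        · rw [Set.indicator_of_notMem hxU, hg m x hx hxU]
    _ = eLpNorm (g m) p (μ.restrict (A ∩ U)) := by
        rw [eLpNorm_indicator_eq_eLpNorm_restrict hU, Measure.restrict_restrict hU, Set.inter_comm]
    _ ≤ ENNReal.ofReal C * eLpNorm (f m) p (μ.restrict (A ∩ U)) := by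
        refine eLpNorm_le_mul_eLpNorm_of_ae_le_mul ?_ p
        filter_upwards [ae_restrict_mem (hA.inter hU)] with x hx using hgf m x hx.1

/-- On the set `A`, the smooth functions `φ k` converge to `u` and their gradients converge to `G`,
both in `L^p`. Unlike in `SmoothTendstoW1`, the field `G` need not be a weak gradient, so that the
notion can be localised with cutoff functions. -/
structure SmoothTendstoOn (A : Set (E n)) (p : ℝ≥0∞) (φ : ℕ → E n → ℝ) (u : E n → ℝ)
    (G : E n → E n) : Prop where
  contDiff : ∀ k, ContDiff ℝ ∞ (φ k)
  tendsto : Tendsto (fun k => eLpNorm (fun x => φ k x - u x) p (volume.restrict A)) atTop (𝓝 0)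
  tendsto_gradient :
    Tendsto (fun k => eLpNorm (fun x => gradient (φ k) x - G x) p (volume.restrict A)) atTop (𝓝 0)

namespace SmoothTendstoOn

variable {A : Set (E n)} {p : ℝ≥0∞} {u : E n → ℝ} {G : E n → E n}

theorem congr {φ : ℕ → E n → ℝ} {v : E n → ℝ} {H : E n → E n} (hφ : SmoothTendstoOn A p φ u G)
    (hA : MeasurableSet A) (hu : Set.EqOn u v A) (hG : Set.EqOn G H A) :
    SmoothTendstoOn A p φ v H where
  contDiff := hφ.contDiff
  tendsto := hφ.tendsto.congr fun k => eLpNorm_congr_ae <| by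
    filter_upwards [ae_restrict_mem hA] with x hx
    rw [hu hx]
  tendsto_gradient := hφ.tendsto_gradient.congr fun k => eLpNorm_congr_ae <| by
    filter_upwards [ae_restrict_mem hA] with x hx
    rw [hG hx]

theorem sum {ι : Type*} {s : Finset ι} {φ : ι → ℕ → E n → ℝ} {v : ι → E n → ℝ}
    {H : ι → E n → E n} (hp : 1 ≤ p) (hφ : ∀ i ∈ s, SmoothTendstoOn A p (φ i) (v i) (H i))
    (hv : ∀ i ∈ s, AEStronglyMeasurable (v i) (volume.restrict A))
    (hH : ∀ i ∈ s, AEStronglyMeasurable (H i) (volume.restrict A)) :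
    SmoothTendstoOn A p (fun k x => ∑ i ∈ s, φ i k x) (fun x => ∑ i ∈ s, v i x)
      fun x => ∑ i ∈ s, H i x where
  contDiff k := ContDiff.sum fun i hi => (hφ i hi).contDiff k
  tendsto := by
    have hlim := tendsto_finsetSum s fun i hi => (hφ i hi).tendsto
    rw [Finset.sum_const_zero] at hlim
    refine tendsto_of_tendsto_of_tendsto_of_le_of_le tendsto_const_nhds hlim (fun _ => zero_le)
      fun k => ?_
    refine le_trans (le_of_eq ?_) (eLpNorm_sum_le (fun i hi =>
      ((hφ i hi).contDiff k).continuous.aestronglyMeasurable.sub (hv i hi)) hp)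
    congr 1
    ext x
    simp
  tendsto_gradient := by
    have hlim := tendsto_finsetSum s fun i hi => (hφ i hi).tendsto_gradient
    rw [Finset.sum_const_zero] at hlim
    refine tendsto_of_tendsto_of_tendsto_of_le_of_le tendsto_const_nhds hlim (fun _ => zero_le)
      fun k => ?_
    have hgrad (i : ι) (hi : i ∈ s) : Continuous (gradient (φ i k)) :=
      continuous_gradient (((hφ i hi).contDiff k).of_le (by norm_cast))
    refine le_trans (le_of_eq ?_) (eLpNorm_sum_le
      (fun i hi => (hgrad i hi).aestronglyMeasurable.sub (hH i hi)) hp)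
    congr 1
    ext1 x
    rw [gradient_sum fun i hi => ((hφ i hi).contDiff k).differentiable (by simp) x]
    simp

end SmoothTendstoOn

theorem SmoothTendstoOn.mul {A U : Set (E n)} {p : ℝ≥0∞} {φ : ℕ → E n → ℝ} {u : E n → ℝ}
    {G : E n → E n} (hφ : SmoothTendstoOn (A ∩ U) p φ u G) (hp : 1 ≤ p) (hA : MeasurableSet A)
    (hbdd : Bornology.IsBounded A) (hU : MeasurableSet U)
    (hu : AEStronglyMeasurable u (volume.restrict A))
    (hG : AEStronglyMeasurable G (volume.restrict A)) {θ : E n → ℝ} (hθ : ContDiff ℝ ∞ θ)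
    (hsupp : tsupport θ ⊆ U) :
    SmoothTendstoOn A p (fun k x => θ x * φ k x) (fun x => θ x * u x)
      fun x => θ x • G x + u x • gradient θ x := by
  have hθ1 : ContDiff ℝ 1 θ := hθ.of_le (by norm_cast)
  obtain ⟨C, hC⟩ := hbdd.isCompact_closure.exists_bound_of_continuousOn hθ.continuous.continuousOn
  obtain ⟨C', hC'⟩ := hbdd.isCompact_closure.exists_bound_of_continuousOn
    (continuous_gradient hθ1).continuousOn
  have hθU {x : E n} (hx : x ∉ U) : θ x = 0 :=
    image_eq_zero_of_notMem_tsupport fun h => hx (hsupp h)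
  have hθU' {x : E n} (hx : x ∉ U) : gradient θ x = 0 := by
    simp [gradient, fderiv_of_notMem_tsupport ℝ fun h => hx (hsupp h)]
  have hfield : Tendsto (fun k => eLpNorm (fun x => θ x • (gradient (φ k) x - G x)) p
      (volume.restrict A)) atTop (𝓝 0) :=
    tendsto_eLpNorm_of_norm_le_mul hA hU hφ.tendsto_gradient (C := C)
      (fun k x hx => by rw [norm_smul]; gcongr; exact hC x (subset_closure hx))
      fun k x _ hx => by simp [hθU hx]
  have hcutoff : Tendsto (fun k => eLpNorm (fun x => (φ k x - u x) • gradient θ x) p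
      (volume.restrict A)) atTop (𝓝 0) :=
    tendsto_eLpNorm_of_norm_le_mul hA hU hφ.tendsto (C := C')
      (fun k x hx => by rw [norm_smul, mul_comm]; gcongr; exact hC' x (subset_closure hx))
      fun k x _ hx => by simp [hθU' hx]
  refine ⟨fun k => hθ.mul (hφ.contDiff k), ?_, ?_⟩
  · refine tendsto_eLpNorm_of_norm_le_mul hA hU hφ.tendsto (C := C) (fun k x hx => ?_)
      fun k x _ hx => by simp [hθU hx]
    rw [← mul_sub, norm_mul]
    gcongr
    exact hC x (subset_closure hx)
  · refine tendsto_of_tendsto_of_tendsto_of_le_of_le tendsto_const_nhds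
      (by simpa using hfield.add hcutoff) (fun _ => zero_le) fun k => ?_
    have hφk : ContDiff ℝ 1 (φ k) := (hφ.contDiff k).of_le (by norm_cast)
    refine le_trans (le_of_eq (congrArg (eLpNorm · p _) ?_)) (eLpNorm_add_le
      (hθ.continuous.aestronglyMeasurable.smul
        ((continuous_gradient hφk).aestronglyMeasurable.sub hG))
      ((hφk.continuous.aestronglyMeasurable.sub hu).smul
        (continuous_gradient hθ1).aestronglyMeasurable) hp)
    ext1 x
    rw [gradient_mul (hθ1.differentiable one_ne_zero x) (hφk.differentiable one_ne_zero x)]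
    simp only [Pi.add_apply, smul_sub, sub_smul]
    abel

theorem exists_finite_smooth_partition {V : Type*} [NormedAddCommGroup V] [NormedSpace ℝ V]
    [FiniteDimensional ℝ V] {K : Set V} (hK : IsCompact K) {U : K → Set V}
    (hU : ∀ x, IsOpen (U x)) (hmem : ∀ x : K, (x : V) ∈ U x) :
    ∃ (t : Finset K) (θ : t → V → ℝ), (∀ i, ContDiff ℝ ∞ (θ i)) ∧ (∀ i x, 0 ≤ θ i x) ∧
      (∀ x ∈ K, ∑ i, θ i x = 1) ∧ ∀ i, tsupport (θ i) ⊆ U i := by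
  obtain ⟨t, ht⟩ := hK.elim_finite_subcover U hU fun x hx => Set.mem_iUnion.2 ⟨⟨x, hx⟩, hmem _⟩
  obtain ⟨θ, hθ⟩ := SmoothPartitionOfUnity.exists_isSubordinate (modelWithCornersSelf ℝ V)
    hK.isClosed (fun i : t => U i) (fun i => hU i) (ht.trans_eq (Set.biUnion_eq_iUnion _ _))
  refine ⟨t, fun i => θ i, fun i => (θ i).contMDiff.contDiff, fun i x => θ.nonneg i x,
    fun x hx => ?_, hθ⟩
  rw [← finsum_eq_sum_of_fintype]
  exact θ.sum_eq_one hx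

theorem tendstoUniformlyOn_sum_mul {α ι : Type*} {s : Finset ι} {K : Set α} {U : ι → Set α}
    {θ : ι → α → ℝ} (hθ : ∀ i x, 0 ≤ θ i x) (hsum : ∀ x ∈ K, ∑ i ∈ s, θ i x = 1)
    (hsupp : ∀ i, ∀ x ∉ U i, θ i x = 0) {φ : ι → ℕ → α → ℝ} {u : α → ℝ}
    (hφ : ∀ i, TendstoUniformlyOn (φ i) u atTop (K ∩ U i)) :
    TendstoUniformlyOn (fun m x => ∑ i ∈ s, θ i x * φ i m x) u atTop K := by
  rw [Metric.tendstoUniformlyOn_iff]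
  intro δ hδ
  filter_upwards [(Finset.eventually_all s).2 fun i _ =>
    Metric.tendstoUniformlyOn_iff.1 (hφ i) (δ / 2) (half_pos hδ)] with m hm x hx
  calc dist (u x) (∑ i ∈ s, θ i x * φ i m x) = ‖∑ i ∈ s, θ i x * (u x - φ i m x)‖ := by
        simp_rw [dist_eq_norm, mul_sub, Finset.sum_sub_distrib, ← Finset.sum_mul, hsum x hx,
          one_mul]
    _ ≤ ∑ i ∈ s, θ i x * (δ / 2) := by
        refine norm_sum_le_of_le s fun i hi => ?_
        rw [norm_mul, Real.norm_of_nonneg (hθ i x)]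
        by_cases hxU : x ∈ U i
        · exact mul_le_mul_of_nonneg_left (hm i hi x ⟨hx, hxU⟩).le (hθ i x)
        · simp [hsupp i x hxU]
    _ < δ := by
        rw [← Finset.sum_mul, hsum x hx]
        linarith

theorem sum_gradient_eq_zero {ι : Type*} {s : Finset ι} {Ω : Set (E n)} (hΩ : IsOpen Ω)
    {θ : ι → E n → ℝ} (hθ : ∀ i, ContDiff ℝ ∞ (θ i)) (hsum : ∀ x ∈ Ω, ∑ i ∈ s, θ i x = 1)
    {x : E n} (hx : x ∈ Ω) : ∑ i ∈ s, gradient (θ i) x = 0 := by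
  rw [← gradient_sum fun i _ => (hθ i).differentiable (by simp) x]
  have hconst : (fun y => ∑ i ∈ s, θ i y) =ᶠ[𝓝 x] fun _ => 1 := by
    filter_upwards [hΩ.mem_nhds hx] with y hy using hsum y hy
  rw [gradient, hconst.fderiv_eq]
  simp

theorem IsLipschitzDomain.exists_inward_mollifiers {Ω : Set (E n)} (hΩ : IsLipschitzDomain Ω)
    {x₀ : E n} (hx₀ : x₀ ∈ closure Ω) :
    ∃ U : Set (E n), IsOpen U ∧ x₀ ∈ U ∧ ∃ (k : ℕ → E n → ℝ) (r : ℕ → ℝ),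
      Tendsto r atTop (𝓝 0) ∧ (∀ m, IsMollifier volume (k m)) ∧
      (∀ m, Function.support (k m) ⊆ Metric.ball 0 (r m)) ∧
      ∀ m, ∀ x ∈ closure Ω ∩ U, ∀ y ∈ tsupport (k m), x - y ∈ Ω := by
  obtain ⟨w, U, hU, hmem, hinward⟩ := hΩ.exists_inward_direction hx₀
  obtain ⟨ε, hε, hball⟩ :=
    exists_seq_forall_of_frequently (hinward.and self_mem_nhdsWithin).frequently
  choose k hk hsupp using fun m => exists_isMollifier volume (ε m • w) (hball m).2
  refine ⟨U, hU, hmem, k, fun m => ε m * (1 + ‖w‖), ?_, hk, fun m => ?_, fun m x hx y hy => ?_⟩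
  · simpa using (tendsto_nhds_of_tendsto_nhdsWithin hε).mul_const (1 + ‖w‖)
  · refine (hsupp m).trans (Metric.ball_subset_ball' ?_)
    rw [dist_zero_right, norm_smul, Real.norm_of_nonneg (hball m).2.le]
    linarith
  · have hdist : y ∈ Metric.closedBall (ε m • w) (ε m) :=
      closure_minimal ((hsupp m).trans Metric.ball_subset_closedBall) Metric.isClosed_closedBall hy
    refine (hball m).1 x hx ?_
    rwa [Metric.mem_closedBall, dist_sub_left]

theorem IsLipschitzDomain.exists_smoothTendstoOn_nhds {Ω : Set (E n)} (hΩ : IsLipschitzDomain Ω)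
    {p : ℝ≥0∞} (hp : 1 ≤ p) (hp' : p ≠ ⊤) {u : E n → ℝ} {G : E n → E n}
    (hu : MemLp u p (volume.restrict Ω)) (hGp : MemLp G p (volume.restrict Ω))
    (hG : IsWeakGradient Ω u G) {x₀ : E n} (hx₀ : x₀ ∈ closure Ω) :
    ∃ U : Set (E n), IsOpen U ∧ x₀ ∈ U ∧ ∃ φ, SmoothTendstoOn (Ω ∩ U) p φ u G ∧
      (ContinuousOn u (closure Ω) → TendstoUniformlyOn φ u atTop (closure Ω ∩ U)) := by
  obtain ⟨U, hU, hmem, k, r, hr, hk, hsupp, hin⟩ := hΩ.exists_inward_mollifiers hx₀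
  have hΩm : MeasurableSet Ω := hΩ.1.measurableSet
  have hle : volume.restrict (Ω ∩ U) ≤ volume.restrict Ω :=
    Measure.restrict_mono_set _ Set.inter_subset_left
  have hloc : LocallyIntegrable (Ω.indicator u) :=
    ((memLp_indicator_iff_restrict hΩm).2 hu).locallyIntegrable hp
  have hGloc : LocallyIntegrable (Ω.indicator G) :=
    ((memLp_indicator_iff_restrict hΩm).2 hGp).locallyIntegrable hp
  refine ⟨U, hU, hmem, fun m => mollify volume (k m) (Ω.indicator u),
    ⟨fun m => (hk m).contDiff_mollify hloc, ?_, ?_⟩, fun hcont => ?_⟩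
  · exact tendsto_of_tendsto_of_tendsto_of_le_of_le tendsto_const_nhds
      (tendsto_eLpNorm_mollify_indicator_sub hp hp' hΩm hu hk hr hsupp) (fun _ => zero_le)
      fun m => eLpNorm_mono_measure _ hle
  · refine tendsto_of_tendsto_of_tendsto_of_le_of_le tendsto_const_nhds
      (tendsto_eLpNorm_mollify_indicator_sub hp hp' hΩm hGp hk hr hsupp) (fun _ => zero_le)
      fun m => (eLpNorm_congr_ae ?_).trans_le (eLpNorm_mono_measure _ hle)
    filter_upwards [ae_restrict_mem (hΩm.inter hU.measurableSet)] with x hx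
    rw [hG.gradient_mollify hΩm hloc hGloc (hk m) (hin m x ⟨subset_closure hx.1, hx.2⟩)]
  · refine tendstoUniformlyOn_mollify_indicator hloc ?_ hk hr hsupp fun m x hx y hy =>
      hin m x hx y (subset_tsupport _ hy)
    exact (hΩ.2.1.isCompact_closure.uniformContinuousOn_of_continuous hcont).mono
      (Set.union_subset Set.inter_subset_left subset_closure)

theorem IsLipschitzDomain.exists_smooth_approx {Ω : Set (E n)} (hΩ : IsLipschitzDomain Ω)
    {p : ℝ≥0∞} (hp : 1 ≤ p) (hp' : p ≠ ⊤) {u : E n → ℝ} {G : E n → E n}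
    (hu : MemLp u p (volume.restrict Ω)) (hGp : MemLp G p (volume.restrict Ω))
    (hG : IsWeakGradient Ω u G) :
    ∃ φ, SmoothTendstoOn Ω p φ u G ∧
      (ContinuousOn u (closure Ω) → TendstoUniformlyOn φ u atTop (closure Ω)) := by
  have hΩm : MeasurableSet Ω := hΩ.1.measurableSet
  choose U hU hmem φ hφ hunif using fun x : closure Ω =>
    hΩ.exists_smoothTendstoOn_nhds hp hp' hu hGp hG x.2
  obtain ⟨t, θ, hθ, hnonneg, hsum, hsupp⟩ :=
    exists_finite_smooth_partition hΩ.2.1.isCompact_closure hU hmem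
  have hθm (i : t) : AEStronglyMeasurable (θ i) (volume.restrict Ω) :=
    (hθ i).continuous.aestronglyMeasurable
  have hgradm (i : t) : AEStronglyMeasurable (gradient (θ i)) (volume.restrict Ω) :=
    (continuous_gradient ((hθ i).of_le (by norm_cast))).aestronglyMeasurable
  have hglued := SmoothTendstoOn.sum (s := Finset.univ) hp
    (fun i _ => (hφ _).mul hp hΩm hΩ.2.1 (hU _).measurableSet hu.1 hGp.1 (hθ i) (hsupp i))
    (fun i _ => (hθm i).mul hu.1) fun i _ => ((hθm i).smul hGp.1).add (hu.1.smul (hgradm i))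
  refine ⟨_, hglued.congr hΩm (fun x hx => ?_) fun x hx => ?_, fun hcont => ?_⟩
  · simp_rw [← Finset.sum_mul, hsum x (subset_closure hx), one_mul]
  · simp_rw [Finset.sum_add_distrib, ← Finset.sum_smul, ← Finset.smul_sum,
      hsum x (subset_closure hx),
      sum_gradient_eq_zero hΩ.1 hθ (fun y hy => hsum y (subset_closure hy)) hx, one_smul,
      smul_zero, add_zero]
  · exact tendstoUniformlyOn_sum_mul hnonneg hsum
      (fun i x hx => image_eq_zero_of_notMem_tsupport fun h => hx (hsupp i h))
      fun i => hunif i hcont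

/-! ### Surface measure on a graph -/

section Hyperplane

variable {V : Type*} [NormedAddCommGroup V] [InnerProductSpace ℝ V]

/-- Decomposition of a Euclidean space into the hyperplane orthogonal to `e` and the line `ℝ ∙ e`,
the latter being parametrised by the coefficient of `e`. -/
noncomputable def hyperplaneProdEquiv [FiniteDimensional ℝ V] {e : V} (he : e ≠ 0) :
    ((ℝ ∙ e)ᗮ × ℝ) ≃L[ℝ] V :=
  (((LinearEquiv.refl ℝ (ℝ ∙ e)ᗮ).prodCongr (LinearEquiv.toSpanNonzeroSingleton ℝ V e he)).trans
    (Submodule.prodEquivOfIsCompl _ _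
      (Submodule.isCompl_orthogonal _).symm)).toContinuousLinearEquiv

theorem hyperplaneProdEquiv_apply [FiniteDimensional ℝ V] {e : V} (he : e ≠ 0)
    (q : (ℝ ∙ e)ᗮ × ℝ) : hyperplaneProdEquiv he q = q.1 + q.2 • e := by
  simp [hyperplaneProdEquiv]

theorem natCast_finrank_orthogonal_singleton [FiniteDimensional ℝ V] {e : V} (he : e ≠ 0) :
    (Module.finrank ℝ (ℝ ∙ e)ᗮ : ℝ) = (Module.finrank ℝ V : ℝ) - 1 := by
  have hadd := Submodule.finrank_add_finrank_orthogonal (ℝ ∙ e)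
  rw [finrank_span_singleton he] at hadd
  rw [← hadd]
  simp

/-- The parametrisation of the graph `{h = 0}` of a chart by the hyperplane orthogonal to `e`. -/
def graphMap (e : V) (h : V → ℝ) (a : (ℝ ∙ e)ᗮ) : V := a + h a • e

theorem antilipschitzWith_graphMap (e : V) (h : V → ℝ) : AntilipschitzWith 1 (graphMap e h) := by
  refine (ℝ ∙ e)ᗮ.lipschitzWith_orthogonalProjectionOnto.to_rightInverse fun a => ?_
  rw [graphMap, map_add, map_smul,
    Submodule.orthogonalProjectionOnto_orthogonalComplement_singleton_eq_zero, smul_zero, add_zero,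
    Submodule.orthogonalProjectionOnto_mem_subspace_eq_self]

section Measure

variable [MeasurableSpace V] [BorelSpace V] [FiniteDimensional ℝ V]

theorem exists_lintegral_eq_mul_lintegral_hyperplane (μ : Measure V) [μ.IsAddHaarMeasure] {e : V}
    (he : e ≠ 0) :
    ∃ c : ℝ≥0, c ≠ 0 ∧ ∀ f : V → ℝ≥0∞, Measurable f →
      ∫⁻ x, f x ∂μ =
        c * ∫⁻ a : (ℝ ∙ e)ᗮ, (∫⁻ s : ℝ, f (a + s • e)) ∂μH[(Module.finrank ℝ V : ℝ) - 1] := by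
  let Φ := hyperplaneProdEquiv he
  rw [← natCast_finrank_orthogonal_singleton he]
  let ν : Measure V :=
    ((μH[Module.finrank ℝ (ℝ ∙ e)ᗮ] : Measure (ℝ ∙ e)ᗮ).prod (volume : Measure ℝ)).map Φ
  have : ν.IsAddHaarMeasure := Φ.isAddHaarMeasure_map _
  refine ⟨μ.addHaarScalarFactor ν,
    (Measure.addHaarScalarFactor_pos_of_isAddHaarMeasure _ _).ne', fun f hf => ?_⟩
  have hΦ : Measurable Φ := Φ.continuous.measurable
  conv_lhs => rw [Measure.isAddLeftInvariant_eq_smul μ ν]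
  rw [lintegral_smul_measure, ENNReal.smul_def, smul_eq_mul, lintegral_map hf hΦ,
    lintegral_prod (fun q => f (Φ q)) (hf.comp hΦ).aemeasurable]
  simp only [Φ, hyperplaneProdEquiv_apply]

theorem exists_lintegral_eq_mul_lintegral_map_graphMap (μ : Measure V) [μ.IsAddHaarMeasure] {e : V}
    (he : e ≠ 0) {h : V → ℝ} (hh : Measurable h) :
    ∃ c : ℝ≥0, c ≠ 0 ∧ ∀ f : V → ℝ≥0∞, Measurable f →
      ∫⁻ x, f x ∂μ = c * ∫⁻ x, (∫⁻ t : ℝ, f (x - t • e))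
        ∂Measure.map (graphMap e h) μH[(Module.finrank ℝ V : ℝ) - 1] := by
  obtain ⟨c, hc, hfubini⟩ := exists_lintegral_eq_mul_lintegral_hyperplane μ he
  refine ⟨c, hc, fun f hf => ?_⟩
  have hlines : Measurable fun x => ∫⁻ t : ℝ, f (x - t • e) :=
    (hf.comp (measurable_fst.sub (measurable_snd.smul_const e))).lintegral_prod_right'
  have hgraph : Measurable (graphMap e h) :=
    measurable_subtype_coe.add ((hh.comp measurable_subtype_coe).smul_const e)
  rw [hfubini f hf, lintegral_map hlines hgraph]
  congr 2 with a
  rw [← lintegral_sub_left_eq_self _ (h a)]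
  simp only [graphMap, sub_smul, add_sub_assoc]

end Measure

end Hyperplane

section HausdorffMeasure

variable {X Y : Type*} [MetricSpace X] [MetricSpace Y] [MeasurableSpace X] [MeasurableSpace Y]
  [BorelSpace X] [BorelSpace Y] {g : X → Y} {K : ℝ≥0} {d : ℝ}

theorem restrict_range_hausdorffMeasure_le_smul_map (hg : LipschitzWith K g) (hd : 0 ≤ d) :
    (μH[d] : Measure Y).restrict (Set.range g) ≤ (K : ℝ≥0∞) ^ d • (μH[d]).map g := by
  refine Measure.le_iff.2 fun s hs => ?_
  rw [Measure.restrict_apply hs, ← Set.image_preimage_eq_inter_range, Measure.smul_apply,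
    Measure.map_apply hg.continuous.measurable hs]
  exact hg.hausdorffMeasure_image_le hd _

theorem map_hausdorffMeasure_le_smul_restrict_range (hg : AntilipschitzWith K g)
    (hgm : Measurable g) (hd : 0 ≤ d) :
    (μH[d]).map g ≤ (K : ℝ≥0∞) ^ d • (μH[d] : Measure Y).restrict (Set.range g) := by
  refine Measure.le_iff.2 fun s hs => ?_
  rw [Measure.smul_apply, Measure.restrict_apply hs, ← Set.image_preimage_eq_inter_range,
    Measure.map_apply hgm hs]
  exact hg.le_hausdorffMeasure_image hd _

end HausdorffMeasure

namespace IsGraphChart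

variable {V : Type*} [NormedAddCommGroup V] [InnerProductSpace ℝ V] {Ω : Set V} {x₀ e : V}
  {L : ℝ≥0} {h : V → ℝ} {R : ℝ}

theorem lipschitzWith_graphMap (hc : IsGraphChart Ω x₀ e L h R) :
    LipschitzWith (1 + L) (graphMap e h) := by
  refine (LipschitzWith.subtype_val _).add (.of_dist_le_mul fun a b => ?_)
  rw [dist_eq_norm, ← sub_smul, norm_smul, hc.norm_eq_one, mul_one]
  exact hc.lipschitz.dist_le_mul (a : V) b

theorem ne_zero (hc : IsGraphChart Ω x₀ e L h R) : e ≠ 0 :=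
  norm_ne_zero_iff.1 (by simp [hc.norm_eq_one])

variable [FiniteDimensional ℝ V]

theorem range_graphMap (hc : IsGraphChart Ω x₀ e L h R) :
    Set.range (graphMap e h) = {x | h x = 0} := by
  ext x
  refine ⟨?_, fun hx => ?_⟩
  · rintro ⟨a, rfl⟩
    simp [graphMap, hc.map_add_smul]
  · obtain ⟨⟨a, s⟩, rfl⟩ := (hyperplaneProdEquiv hc.ne_zero).surjective x
    rw [hyperplaneProdEquiv_apply] at hx ⊢
    have hs : h a - s = 0 := by rwa [← hc.map_add_smul]
    exact ⟨a, by rw [graphMap, sub_eq_zero.1 hs]⟩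

variable [MeasurableSpace V] [BorelSpace V] (μ : Measure V) [μ.IsAddHaarMeasure]

theorem exists_lintegral_graph_lines_le (hc : IsGraphChart Ω x₀ e L h R) :
    ∃ C : ℝ≥0, ∀ f : V → ℝ≥0∞, Measurable f →
      ∫⁻ x in {x | h x = 0}, (∫⁻ t : ℝ, f (x - t • e)) ∂μH[(Module.finrank ℝ V : ℝ) - 1] ≤
        C * ∫⁻ x, f x ∂μ := by
  obtain ⟨c, hc0, hfubini⟩ := exists_lintegral_eq_mul_lintegral_map_graphMap μ hc.ne_zero
    hc.lipschitz.continuous.measurable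
  have hd : 0 ≤ (Module.finrank ℝ V : ℝ) - 1 := by
    rw [← natCast_finrank_orthogonal_singleton hc.ne_zero]
    positivity
  refine ⟨(1 + L) ^ ((Module.finrank ℝ V : ℝ) - 1) / c, fun f hf => ?_⟩
  rw [hfubini f hf, ← mul_assoc, ← ENNReal.coe_mul, div_mul_cancel₀ _ hc0,
    ENNReal.coe_rpow_of_nonneg _ hd, ← smul_eq_mul, ← lintegral_smul_measure, ← hc.range_graphMap]
  exact lintegral_mono' (restrict_range_hausdorffMeasure_le_smul_map hc.lipschitzWith_graphMap hd)
    le_rfl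

theorem exists_lintegral_le_graph_lines (hc : IsGraphChart Ω x₀ e L h R) :
    ∃ C : ℝ≥0, ∀ f : V → ℝ≥0∞, Measurable f →
      ∫⁻ x, f x ∂μ ≤ C * ∫⁻ x in {x | h x = 0}, (∫⁻ t : ℝ, f (x - t • e))
        ∂μH[(Module.finrank ℝ V : ℝ) - 1] := by
  obtain ⟨c, -, hfubini⟩ := exists_lintegral_eq_mul_lintegral_map_graphMap μ hc.ne_zero
    hc.lipschitz.continuous.measurable
  have hd : 0 ≤ (Module.finrank ℝ V : ℝ) - 1 := by
    rw [← natCast_finrank_orthogonal_singleton hc.ne_zero]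
    positivity
  have hle := map_hausdorffMeasure_le_smul_restrict_range (antilipschitzWith_graphMap e h)
    hc.lipschitzWith_graphMap.continuous.measurable hd
  rw [hc.range_graphMap, ENNReal.coe_one, ENNReal.one_rpow, one_smul] at hle
  refine ⟨c, fun f hf => ?_⟩
  rw [hfubini f hf]
  gcongr

end IsGraphChart

/-! ### The trace inequality -/

section Line

variable {V F : Type*} [NormedAddCommGroup V] [NormedSpace ℝ V] [NormedAddCommGroup F]
  [NormedSpace ℝ F] {φ : V → F} {e : V}

theorem enorm_sub_le_lintegral_fderiv_line (hφ : ContDiff ℝ 1 φ) (he : ‖e‖ = 1) (y : V) {t : ℝ}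
    (ht : 0 ≤ t) :
    ‖φ (y - t • e) - φ y‖ₑ ≤ ∫⁻ s in Set.Ioc 0 t, ‖fderiv ℝ φ (y - s • e)‖ₑ := by
  have hline : ContDiff ℝ 1 fun s : ℝ => φ (y - s • e) := hφ.comp (by fun_prop)
  have hderiv (s : ℝ) : ‖deriv (fun s : ℝ => φ (y - s • e)) s‖ₑ ≤ ‖fderiv ℝ φ (y - s • e)‖ₑ := by
    have hs : HasDerivAt (fun s : ℝ => y - s • e) (-e) s := by
      simpa using ((hasDerivAt_id s).smul_const e).const_sub y
    have hcomp : HasDerivAt (fun s : ℝ => φ (y - s • e)) (fderiv ℝ φ (y - s • e) (-e)) s :=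
      (hφ.differentiable one_ne_zero _).hasFDerivAt.comp_hasDerivAt s hs
    rw [hcomp.deriv, enorm_le_iff_norm_le]
    simpa [he] using (fderiv ℝ φ (y - s • e)).le_opNorm (-e)
  have hftc := enorm_sub_le_lintegral_deriv_of_contDiffOn_Icc hline.contDiffOn ht
  rw [zero_smul, sub_zero] at hftc
  rw [restrict_Ioc_eq_restrict_Icc]
  exact hftc.trans (lintegral_mono hderiv)

theorem enorm_rpow_le_lintegral_line (hφ : ContDiff ℝ 1 φ) (he : ‖e‖ = 1) (y : V) {r : ℝ}
    (hr : 0 < r) (hr1 : r ≤ 1) {p : ℝ} (hp : 1 ≤ p) :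
    ‖φ y‖ₑ ^ p ≤ (ENNReal.ofReal r)⁻¹ *
      ∫⁻ t in Set.Ioc 0 r, (‖φ (y - t • e)‖ₑ + ‖fderiv ℝ φ (y - t • e)‖ₑ) ^ p := by
  let ν : Measure ℝ := (ENNReal.ofReal r)⁻¹ • volume.restrict (Set.Ioc 0 r)
  have hν : IsProbabilityMeasure ν :=
    ⟨by simp [ν, ENNReal.inv_mul_cancel (ENNReal.ofReal_pos.2 hr).ne']⟩
  have hline : Continuous fun t : ℝ => y - t • e := by fun_prop
  have hvalue : Measurable fun t : ℝ => ‖φ (y - t • e)‖ₑ :=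
    (hφ.continuous.comp hline).enorm.measurable
  have hderiv : Measurable fun t : ℝ => ‖fderiv ℝ φ (y - t • e)‖ₑ :=
    ((hφ.continuous_fderiv one_ne_zero).comp hline).enorm.measurable
  have hpoint : ∀ᵐ t ∂ν, ‖φ y‖ₑ ≤ ‖φ (y - t • e)‖ₑ + ∫⁻ s, ‖fderiv ℝ φ (y - s • e)‖ₑ ∂ν := by
    refine Measure.ae_smul_measure (ae_restrict_of_forall_mem measurableSet_Ioc fun t ht => ?_) _
    calc ‖φ y‖ₑ ≤ ‖φ (y - t • e)‖ₑ + ‖φ (y - t • e) - φ y‖ₑ := by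
          simpa using enorm_sub_le (a := φ (y - t • e)) (b := φ (y - t • e) - φ y)
      _ ≤ ‖φ (y - t • e)‖ₑ + ∫⁻ s in Set.Ioc 0 r, ‖fderiv ℝ φ (y - s • e)‖ₑ := by
          gcongr
          exact (enorm_sub_le_lintegral_fderiv_line hφ he y ht.1.le).trans
            (lintegral_mono_set (Set.Ioc_subset_Ioc_right ht.2))
      _ ≤ ‖φ (y - t • e)‖ₑ + ∫⁻ s, ‖fderiv ℝ φ (y - s • e)‖ₑ ∂ν := by
          rw [lintegral_smul_measure, smul_eq_mul]
          gcongr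
          exact le_mul_of_one_le_left zero_le (ENNReal.one_le_inv.2 (by simpa using hr1))
  have hmean : ‖φ y‖ₑ ≤ ∫⁻ t, (‖φ (y - t • e)‖ₑ + ‖fderiv ℝ φ (y - t • e)‖ₑ) ∂ν := by
    simpa [lintegral_add_left hvalue] using lintegral_mono_ae hpoint
  calc ‖φ y‖ₑ ^ p ≤ (∫⁻ t, (‖φ (y - t • e)‖ₑ + ‖fderiv ℝ φ (y - t • e)‖ₑ) ∂ν) ^ p := by gcongr
    _ ≤ ∫⁻ t, (‖φ (y - t • e)‖ₑ + ‖fderiv ℝ φ (y - t • e)‖ₑ) ^ p ∂ν :=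
        lintegral_rpow_le_of_isProbabilityMeasure ν hp (hvalue.add hderiv).aemeasurable
    _ = _ := by rw [lintegral_smul_measure, smul_eq_mul]

theorem lintegral_line_indicator_le (hφ : ContDiff ℝ 1 φ) (he : ‖e‖ = 1) {y : V} {a : ℝ}
    {S T : Set V} (hS : ∀ t : ℝ, y - t • e ∈ S → t ∈ Set.Ioc 0 a)
    (hT : ∀ t ∈ Set.Ioc 0 a, y - t • e ∈ T) :
    ∫⁻ t : ℝ, S.indicator (‖φ ·‖ₑ) (y - t • e) ≤ ENNReal.ofReal a *
      (‖φ y‖ₑ + ∫⁻ t : ℝ, T.indicator (‖fderiv ℝ φ ·‖ₑ) (y - t • e)) := by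
  set I := ∫⁻ t : ℝ, T.indicator (‖fderiv ℝ φ ·‖ₑ) (y - t • e)
  have hderiv : ∫⁻ t in Set.Ioc 0 a, ‖fderiv ℝ φ (y - t • e)‖ₑ ≤ I := by
    rw [← lintegral_indicator measurableSet_Ioc]
    refine lintegral_mono fun t => Set.indicator_apply_le' (fun ht => ?_) fun _ => zero_le
    rw [Set.indicator_of_mem (hT t ht)]
  calc ∫⁻ t : ℝ, S.indicator (‖φ ·‖ₑ) (y - t • e)
      ≤ ∫⁻ t : ℝ, (Set.Ioc 0 a).indicator (fun _ => ‖φ y‖ₑ + I) t := by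
        refine lintegral_mono fun t => Set.indicator_apply_le' (fun ht => ?_) fun _ => zero_le
        have hta := hS t ht
        rw [Set.indicator_of_mem hta]
        calc ‖φ (y - t • e)‖ₑ ≤ ‖φ y‖ₑ + ‖φ (y - t • e) - φ y‖ₑ := by
              simpa using enorm_add_le (φ y) (φ (y - t • e) - φ y)
          _ ≤ ‖φ y‖ₑ + I := by
              gcongr
              exact (enorm_sub_le_lintegral_fderiv_line hφ he y hta.1.le).trans <|
                (lintegral_mono_set (Set.Ioc_subset_Ioc_right hta.2)).trans hderiv
    _ = ENNReal.ofReal a * (‖φ y‖ₑ + I) := by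
        rw [lintegral_indicator_const measurableSet_Ioc, Real.volume_Ioc, sub_zero, mul_comm]

end Line

/-- The trace inequality for smooth functions on the part `s` of the boundary, with a constant that
does not depend on the exponent. -/
def HasTraceInequalityOn (Ω s : Set (E n)) : Prop :=
  ∃ C : ℝ≥0, ∀ p : ℝ, 1 ≤ p → ∀ φ : E n → ℝ, ContDiff ℝ 1 φ →
    ∫⁻ y in s, ‖φ y‖ₑ ^ p ∂surfaceMeasure Ω ≤
      C * ∫⁻ x in Ω, (‖φ x‖ₑ + ‖gradient φ x‖ₑ) ^ p

namespace HasTraceInequalityOn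

variable {Ω s t : Set (E n)}

theorem mono (ht : HasTraceInequalityOn Ω t) (hst : s ⊆ t) : HasTraceInequalityOn Ω s := by
  obtain ⟨C, hC⟩ := ht
  exact ⟨C, fun p hp φ hφ => (lintegral_mono_set hst).trans (hC p hp φ hφ)⟩

theorem union (hs : HasTraceInequalityOn Ω s) (ht : HasTraceInequalityOn Ω t) :
    HasTraceInequalityOn Ω (s ∪ t) := by
  obtain ⟨C, hC⟩ := hs
  obtain ⟨D, hD⟩ := ht
  refine ⟨C + D, fun p hp φ hφ => (lintegral_union_le _ _ _).trans ?_⟩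
  rw [ENNReal.coe_add, add_mul]
  exact add_le_add (hC p hp φ hφ) (hD p hp φ hφ)

end HasTraceInequalityOn

theorem IsGraphChart.exists_hasTraceInequalityOn {Ω : Set (E n)} {x₀ e : E n} {L : ℝ≥0}
    {h : E n → ℝ} {R : ℝ} (hc : IsGraphChart Ω x₀ e L h R) (hΩ : IsOpen Ω) :
    ∃ U ∈ 𝓝 x₀, HasTraceInequalityOn Ω U := by
  obtain ⟨C, hC⟩ := hc.exists_lintegral_graph_lines_le volume
  rw [finrank_euclideanSpace_fin] at hC
  obtain ⟨r, hr0, hr1, hrR⟩ : ∃ r : ℝ, 0 < r ∧ r ≤ 1 ∧ r + r ≤ R :=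
    ⟨min 1 (R / 2), lt_min one_pos (half_pos hc.radius_pos), min_le_left _ _,
      by linarith [min_le_right 1 (R / 2)]⟩
  refine ⟨Metric.ball x₀ r, Metric.ball_mem_nhds _ hr0, (Real.toNNReal r)⁻¹ * C,
    fun p hp φ hφ => ?_⟩
  let f : E n → ℝ≥0∞ := fun x => (‖φ x‖ₑ + ‖gradient φ x‖ₑ) ^ p
  have hf : Measurable f :=
    (hφ.continuous.enorm.add (continuous_gradient hφ).enorm).measurable.pow_const p
  have hgraph : Metric.ball x₀ r ∩ frontier Ω ⊆ {x | h x = 0} := fun y hy =>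
    hc.eq_zero_of_mem_frontier hΩ (Metric.ball_subset_ball (by linarith) hy.1) hy.2
  have hline : ∀ y ∈ Metric.ball x₀ r ∩ frontier Ω,
      ‖φ y‖ₑ ^ p ≤ (ENNReal.ofReal r)⁻¹ * ∫⁻ t : ℝ, Ω.indicator f (y - t • e) := fun y hy => by
    refine (enorm_rpow_le_lintegral_line hφ hc.norm_eq_one y hr0 hr1 hp).trans ?_
    rw [← lintegral_indicator measurableSet_Ioc]
    gcongr with t
    refine Set.indicator_apply_le' (fun ht => ?_) fun _ => zero_le
    have hmem : y - t • e ∈ Ω :=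
      hc.sub_smul_mem (hgraph hy) ht.1 (by linarith [Metric.mem_ball.1 hy.1, ht.2])
    rw [Set.indicator_of_mem hmem, ← enorm_gradient]
  rw [surfaceMeasure, Measure.restrict_restrict Metric.isOpen_ball.measurableSet]
  calc _ ≤ ∫⁻ y in Metric.ball x₀ r ∩ frontier Ω, (ENNReal.ofReal r)⁻¹ *
          (∫⁻ t : ℝ, Ω.indicator f (y - t • e)) ∂μH[(n : ℝ) - 1] :=
        setLIntegral_mono' (Metric.isOpen_ball.measurableSet.inter measurableSet_frontier) hline
    _ ≤ ∫⁻ y in {x | h x = 0}, (ENNReal.ofReal r)⁻¹ *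
          (∫⁻ t : ℝ, Ω.indicator f (y - t • e)) ∂μH[(n : ℝ) - 1] := lintegral_mono_set hgraph
    _ ≤ (ENNReal.ofReal r)⁻¹ * (C * ∫⁻ x, Ω.indicator f x) := by
        rw [lintegral_const_mul' _ _ (by simpa using hr0)]
        gcongr
        exact hC _ (hf.indicator hΩ.measurableSet)
    _ = _ := by
        rw [lintegral_indicator hΩ.measurableSet, ENNReal.coe_mul,
          ENNReal.coe_inv (Real.toNNReal_pos.2 hr0).ne', mul_assoc]
        rfl

theorem IsLipschitzDomain.isCompact_frontier {Ω : Set (E n)} (hΩ : IsLipschitzDomain Ω) :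
    IsCompact (frontier Ω) :=
  hΩ.2.1.isCompact_closure.of_isClosed_subset isClosed_frontier frontier_subset_closure

theorem IsLipschitzDomain.hasTraceInequalityOn {Ω : Set (E n)} (hΩ : IsLipschitzDomain Ω) :
    HasTraceInequalityOn Ω (frontier Ω) := by
  refine hΩ.isCompact_frontier.induction_on ⟨0, by simp⟩ (fun _ _ hst ht => ht.mono hst)
    (fun _ _ hs ht => hs.union ht) fun x hx => ?_
  obtain ⟨e, L, h, R, hc⟩ := hΩ.exists_isGraphChart hx
  obtain ⟨U, hU, hineq⟩ := hc.exists_hasTraceInequalityOn hΩ.1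
  exact ⟨U, mem_nhdsWithin_of_mem_nhds hU, hineq⟩

/-! ### Boundary layers -/

section BoundaryLayer

variable {X : Type*} [PseudoMetricSpace X]

/-- The points of `Ω` at distance less than `δ` from the complement of `Ω`. -/
def boundaryLayer (Ω : Set X) (δ : ℝ) : Set X := Ω ∩ Metric.thickening δ Ωᶜ

theorem boundaryLayer_subset {Ω : Set X} {δ : ℝ} : boundaryLayer Ω δ ⊆ Ω := Set.inter_subset_left

theorem boundaryLayer_mono (Ω : Set X) {δ δ' : ℝ} (h : δ ≤ δ') :
    boundaryLayer Ω δ ⊆ boundaryLayer Ω δ' :=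
  Set.inter_subset_inter_right _ (Metric.thickening_mono h _)

theorem isOpen_boundaryLayer {Ω : Set X} (hΩ : IsOpen Ω) (δ : ℝ) : IsOpen (boundaryLayer Ω δ) :=
  hΩ.inter Metric.isOpen_thickening

theorem boundaryLayer_subset_thickening_frontier {V : Type*} [NormedAddCommGroup V]
    [NormedSpace ℝ V] {Ω : Set V} {δ : ℝ} :
    boundaryLayer Ω δ ⊆ Metric.thickening δ (frontier Ω) := by
  rintro x ⟨hxΩ, hx⟩
  obtain ⟨z, hz, hxz⟩ := Metric.mem_thickening_iff.1 hx
  obtain ⟨y, hyx, hy⟩ := isPreconnected_closed_iff.1 (convex_ball x δ).isPreconnected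
    (closure Ω) (closure Ωᶜ) isClosed_closure isClosed_closure
    (fun y _ => (em (y ∈ Ω)).imp (subset_closure ·) (subset_closure ·))
    ⟨x, Metric.mem_ball_self (dist_nonneg.trans_lt hxz), subset_closure hxΩ⟩
    ⟨z, Metric.mem_ball'.2 hxz, subset_closure hz⟩
  rw [← frontier_eq_closure_inter_closure] at hy
  exact Metric.mem_thickening_iff.2 ⟨y, hy, Metric.mem_ball'.1 hyx⟩

theorem tendsto_setLIntegral_boundaryLayer [MeasurableSpace X] [OpensMeasurableSpace X]
    {μ : Measure X} {Ω : Set X} (hΩ : IsOpen Ω) {f : X → ℝ≥0∞} (hf : ∫⁻ x in Ω, f x ∂μ ≠ ⊤) :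
    Tendsto (fun δ => ∫⁻ x in boundaryLayer Ω δ, f x ∂μ) (𝓝 0) (𝓝 0) := by
  let ν : Measure X := (μ.restrict Ω).withDensity f
  have hν (s : Set X) (hs : MeasurableSet s) : ν s = ∫⁻ x in Ω ∩ s, f x ∂μ := by
    rw [withDensity_apply _ hs, Measure.restrict_restrict hs, Set.inter_comm]
  have hfin : IsFiniteMeasure ν := isFiniteMeasure_withDensity hf
  have hlim := tendsto_measure_thickening_of_isClosed (μ := ν) (s := Ωᶜ)
    ⟨1, one_pos, measure_ne_top _ _⟩ hΩ.isClosed_compl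
  rw [hν _ hΩ.measurableSet.compl, Set.inter_compl_self, setLIntegral_empty] at hlim
  rw [← nhdsLE_sup_nhdsGT]
  refine .sup ?_ (hlim.congr fun δ => hν _ Metric.isOpen_thickening.measurableSet)
  refine tendsto_const_nhds.congr' ?_
  filter_upwards [self_mem_nhdsWithin] with δ hδ
  rw [boundaryLayer, Metric.thickening_of_nonpos hδ, Set.inter_empty, setLIntegral_empty]

end BoundaryLayer

namespace IsGraphChart

variable {V : Type*} [NormedAddCommGroup V] [NormedSpace ℝ V] {Ω : Set V} {x₀ e : V} {L : ℝ≥0}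
  {h : V → ℝ} {R δ : ℝ}

theorem mem_frontier (hc : IsGraphChart Ω x₀ e L h R) {y : V} (hy : h y = 0)
    (hyR : y ∈ Metric.ball x₀ R) : y ∈ frontier Ω := by
  refine frontier_eq_closure_inter_closure.ge
    ⟨?_, subset_closure fun hyΩ => ((hc.mem_iff y hyR).1 hyΩ).ne' hy⟩
  have hlim : Tendsto (fun t : ℝ => y - t • e) (𝓝[>] 0) (𝓝 y) := by
    have hcont : Continuous fun t : ℝ => y - t • e := by fun_prop
    simpa using (hcont.tendsto 0).mono_left nhdsWithin_le_nhds
  refine mem_closure_of_tendsto hlim ?_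
  filter_upwards [Ioo_mem_nhdsGT (sub_pos.2 (Metric.mem_ball.1 hyR))] with t ht
  exact hc.sub_smul_mem hy ht.1 (by linarith [ht.2])

theorem mem_Ioc_of_mem_boundaryLayer (hc : IsGraphChart Ω x₀ e L h R) {x : V}
    (hx : x ∈ boundaryLayer Ω δ) (hxR : dist x x₀ + δ ≤ R) : h x ∈ Set.Ioc 0 (L * δ) := by
  obtain ⟨z, hz, hxz⟩ := Metric.mem_thickening_iff.1 hx.2
  have hδ : 0 < δ := dist_nonneg.trans_lt hxz
  have hzR : z ∈ Metric.ball x₀ R := by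
    rw [Metric.mem_ball]
    linarith [dist_triangle_left z x₀ x]
  have hxR : x ∈ Metric.ball x₀ R := by
    rw [Metric.mem_ball]
    linarith
  have hhz : h z ≤ 0 := not_lt.1 fun hpos => hz ((hc.mem_iff z hzR).2 hpos)
  have hLδ : L * dist x z ≤ L * δ := by gcongr
  exact ⟨(hc.mem_iff x hxR).1 hx.1, by linarith [hc.map_sub_mul_dist_le x z]⟩

theorem sub_smul_mem_boundaryLayer (hc : IsGraphChart Ω x₀ e L h R) {y : V} (hy : h y = 0)
    {t : ℝ} (ht : 0 < t) (htδ : t < δ) (htR : dist y x₀ + t < R) :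
    y - t • e ∈ boundaryLayer Ω δ := by
  refine ⟨hc.sub_smul_mem hy ht htR, Metric.mem_thickening_iff.2 ⟨y, fun hyΩ => ?_, ?_⟩⟩
  · exact ((hc.mem_iff y (Metric.mem_ball.2 (by linarith))).1 hyΩ).ne' hy
  · rwa [hc.dist_sub_smul y ht.le]

theorem lintegral_line_indicator_boundaryLayer_le {F : Type*} [NormedAddCommGroup F]
    [NormedSpace ℝ F] (hc : IsGraphChart Ω x₀ e L h R) (hδ : 0 < δ) (hδR : (L + 1) * δ < R / 3)
    {φ : V → F} (hφ : ContDiff ℝ 1 φ) {y : V} (hy : h y = 0) :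
    ∫⁻ t : ℝ, (boundaryLayer Ω δ ∩ Metric.ball x₀ (R / 3)).indicator (‖φ ·‖ₑ) (y - t • e) ≤
      ENNReal.ofReal (L * δ) * ((frontier Ω).indicator (‖φ ·‖ₑ) y +
        ∫⁻ t : ℝ, (boundaryLayer Ω ((L + 1) * δ)).indicator (‖fderiv ℝ φ ·‖ₑ) (y - t • e)) := by
  have hLδ : 0 ≤ L * δ := by positivity
  have hheight : ∀ t : ℝ, y - t • e ∈ boundaryLayer Ω δ ∩ Metric.ball x₀ (R / 3) →
      t ∈ Set.Ioc 0 (L * δ) := fun t ht => by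
    have hmem := hc.mem_Ioc_of_mem_boundaryLayer ht.1 (by linarith [Metric.mem_ball.1 ht.2])
    rwa [hc.map_sub_smul, hy, zero_add] at hmem
  by_cases hex : ∃ t : ℝ, y - t • e ∈ boundaryLayer Ω δ ∩ Metric.ball x₀ (R / 3)
  · obtain ⟨t, ht⟩ := hex
    have hyR : dist y x₀ < R / 3 + L * δ := by
      linarith [dist_triangle_left y x₀ (y - t • e), hc.dist_sub_smul y (hheight t ht).1.le,
        (hheight t ht).2, Metric.mem_ball.1 ht.2]
    rw [Set.indicator_of_mem (hc.mem_frontier hy (Metric.mem_ball.2 (by linarith)))]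
    exact lintegral_line_indicator_le hφ hc.norm_eq_one hheight fun s hs =>
      hc.sub_smul_mem_boundaryLayer hy hs.1 (by linarith [hs.2]) (by linarith [hs.2])
  · push Not at hex
    simp [Set.indicator_of_notMem (hex _)]

end IsGraphChart

/-- The part in `U` of the integral of `|φ|` over a thin boundary layer of `Ω` is at most a constant
times the width of the layer times the sum of the integrals of `|φ|` over `∂Ω` and of `|∇φ|` over a
comparable layer. -/
def HasLayerInequalityOn (Ω U : Set (E n)) : Prop :=
  ∃ (C M : ℝ≥0) (δ₀ : ℝ), 0 < δ₀ ∧ ∀ δ ∈ Set.Ioo 0 δ₀, ∀ φ : E n → ℝ, ContDiff ℝ 1 φ →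
    ∫⁻ x in boundaryLayer Ω δ ∩ U, ‖φ x‖ₑ ≤ C * ENNReal.ofReal δ *
      (∫⁻ y, ‖φ y‖ₑ ∂surfaceMeasure Ω + ∫⁻ x in boundaryLayer Ω (M * δ), ‖gradient φ x‖ₑ)

theorem HasLayerInequalityOn.union {Ω U U' : Set (E n)} (hU : HasLayerInequalityOn Ω U)
    (hU' : HasLayerInequalityOn Ω U') : HasLayerInequalityOn Ω (U ∪ U') := by
  obtain ⟨C, M, δ₀, hδ₀, hineq⟩ := hU
  obtain ⟨C', M', δ₀', hδ₀', hineq'⟩ := hU'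
  refine ⟨C + C', max M M', min δ₀ δ₀', lt_min hδ₀ hδ₀', fun δ hδ φ hφ => ?_⟩
  have hδ_nonneg := hδ.1.le
  rw [Set.inter_union_distrib_left, ENNReal.coe_add, add_mul, add_mul]
  refine (lintegral_union_le _ _ _).trans (add_le_add ?_ ?_)
  · refine (hineq δ ⟨hδ.1, hδ.2.trans_le (min_le_left _ _)⟩ φ hφ).trans ?_
    gcongr
    exact boundaryLayer_mono Ω (by gcongr; exact le_max_left _ _)
  · refine (hineq' δ ⟨hδ.1, hδ.2.trans_le (min_le_right _ _)⟩ φ hφ).trans ?_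
    gcongr
    exact boundaryLayer_mono Ω (by gcongr; exact le_max_right _ _)

theorem IsGraphChart.exists_lintegral_frontier_add_lines_le {Ω : Set (E n)} {x₀ e : E n}
    {L : ℝ≥0} {h : E n → ℝ} {R : ℝ} (hc : IsGraphChart Ω x₀ e L h R) :
    ∃ C : ℝ≥0, ∀ f g : E n → ℝ≥0∞, Measurable f → Measurable g → ∀ T, MeasurableSet T →
      ∫⁻ y in {x | h x = 0}, ((frontier Ω).indicator f y + ∫⁻ t : ℝ, T.indicator g (y - t • e))
        ∂μH[(n : ℝ) - 1] ≤ C * (∫⁻ y, f y ∂surfaceMeasure Ω + ∫⁻ x in T, g x) := by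
  obtain ⟨C, hC⟩ := hc.exists_lintegral_graph_lines_le volume
  rw [finrank_euclideanSpace_fin] at hC
  refine ⟨max 1 C, fun f g hf hg T hT => ?_⟩
  rw [lintegral_add_left (hf.indicator measurableSet_frontier), mul_add]
  gcongr
  · calc ∫⁻ y in {x | h x = 0}, (frontier Ω).indicator f y ∂μH[(n : ℝ) - 1]
        ≤ ∫⁻ y, f y ∂surfaceMeasure Ω := by
          rw [surfaceMeasure, ← lintegral_indicator measurableSet_frontier]
          exact lintegral_mono' Measure.restrict_le_self le_rfl
      _ ≤ (max 1 C : ℝ≥0) * ∫⁻ y, f y ∂surfaceMeasure Ω :=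
          le_mul_of_one_le_left zero_le (by exact_mod_cast le_max_left 1 C)
  · calc _ ≤ C * ∫⁻ x, T.indicator g x := hC _ (hg.indicator hT)
      _ ≤ (max 1 C : ℝ≥0) * ∫⁻ x in T, g x := by
          rw [lintegral_indicator hT]
          gcongr
          exact le_max_right _ _

theorem IsGraphChart.hasLayerInequalityOn_ball {Ω : Set (E n)} {x₀ e : E n} {L : ℝ≥0}
    {h : E n → ℝ} {R : ℝ} (hc : IsGraphChart Ω x₀ e L h R) (hΩ : IsOpen Ω) :
    HasLayerInequalityOn Ω (Metric.ball x₀ (R / 3)) := by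
  obtain ⟨C, hC⟩ := hc.exists_lintegral_frontier_add_lines_le
  obtain ⟨D, hD⟩ := hc.exists_lintegral_le_graph_lines volume
  rw [finrank_euclideanSpace_fin] at hD
  have hR := hc.radius_pos
  refine ⟨D * L * C, L + 1, R / 3 / (L + 1), by positivity, fun δ hδ φ hφ => ?_⟩
  have hδR : (L + 1) * δ < R / 3 := by
    rw [mul_comm]
    exact (lt_div_iff₀ (by positivity)).1 hδ.2
  rw [NNReal.coe_add, NNReal.coe_one]
  set S := boundaryLayer Ω δ ∩ Metric.ball x₀ (R / 3)
  set T := boundaryLayer Ω ((L + 1) * δ)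
  have hS : MeasurableSet S := ((isOpen_boundaryLayer hΩ _).inter Metric.isOpen_ball).measurableSet
  have hT : MeasurableSet T := (isOpen_boundaryLayer hΩ _).measurableSet
  have hvalue : Measurable (‖φ ·‖ₑ) := hφ.continuous.enorm.measurable
  have hgrad : Measurable (‖gradient φ ·‖ₑ) := (continuous_gradient hφ).enorm.measurable
  have hgraph : MeasurableSet {x | h x = 0} :=
    (isClosed_eq hc.lipschitz.continuous continuous_const).measurableSet
  calc ∫⁻ x in S, ‖φ x‖ₑ = ∫⁻ x, S.indicator (‖φ ·‖ₑ) x := (lintegral_indicator hS _).symm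
    _ ≤ D * ∫⁻ y in {x | h x = 0}, (∫⁻ t : ℝ, S.indicator (‖φ ·‖ₑ) (y - t • e))
          ∂μH[(n : ℝ) - 1] := hD _ (hvalue.indicator hS)
    _ ≤ D * ∫⁻ y in {x | h x = 0}, ENNReal.ofReal (L * δ) * ((frontier Ω).indicator (‖φ ·‖ₑ) y +
          ∫⁻ t : ℝ, T.indicator (‖gradient φ ·‖ₑ) (y - t • e)) ∂μH[(n : ℝ) - 1] := by
        gcongr 1
        refine setLIntegral_mono' hgraph fun y hy => ?_
        simp_rw [enorm_gradient]
        exact hc.lintegral_line_indicator_boundaryLayer_le hδ.1 hδR hφ hy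
    _ ≤ D * (ENNReal.ofReal (L * δ) *
          (C * (∫⁻ y, ‖φ y‖ₑ ∂surfaceMeasure Ω + ∫⁻ x in T, ‖gradient φ x‖ₑ))) := by
        rw [lintegral_const_mul' _ _ ENNReal.ofReal_ne_top]
        gcongr
        exact hC _ _ hvalue hgrad T hT
    _ = _ := by
        rw [ENNReal.ofReal_mul L.coe_nonneg, ENNReal.ofReal_coe_nnreal, ENNReal.coe_mul,
          ENNReal.coe_mul]
        ring

theorem IsLipschitzDomain.hasLayerInequalityOn_univ {Ω : Set (E n)} (hΩ : IsLipschitzDomain Ω) :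
    HasLayerInequalityOn Ω Set.univ := by
  obtain ⟨U, hUopen, hfrontier, C, M, δ₀, hδ₀, hineq⟩ :
      ∃ U, IsOpen U ∧ frontier Ω ⊆ U ∧ HasLayerInequalityOn Ω U := by
    refine hΩ.isCompact_frontier.induction_on
      (p := fun s => ∃ U, IsOpen U ∧ s ⊆ U ∧ HasLayerInequalityOn Ω U) ?_ ?_ ?_ fun x hx => ?_
    · exact ⟨∅, isOpen_empty, subset_rfl, 0, 0, 1, one_pos, by simp⟩
    · rintro s t hst ⟨U, hUopen, htU, hU⟩
      exact ⟨U, hUopen, hst.trans htU, hU⟩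
    · rintro s t ⟨U, hUopen, hsU, hU⟩ ⟨U', hUopen', htU', hU'⟩
      exact ⟨U ∪ U', hUopen.union hUopen', Set.union_subset_union hsU htU', hU.union hU'⟩
    · obtain ⟨e, L, h, R, hc⟩ := hΩ.exists_isGraphChart hx
      have hR : 0 < R / 3 := by linarith [hc.radius_pos]
      exact ⟨_, mem_nhdsWithin_of_mem_nhds (Metric.ball_mem_nhds x hR), _, Metric.isOpen_ball,
        subset_rfl, hc.hasLayerInequalityOn_ball hΩ.1⟩
  obtain ⟨η, hη, hthick⟩ := hΩ.isCompact_frontier.exists_thickening_subset_open hUopen hfrontier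
  refine ⟨C, M, min δ₀ η, lt_min hδ₀ hη, fun δ hδ φ hφ => ?_⟩
  have hlayer : boundaryLayer Ω δ ⊆ U := boundaryLayer_subset_thickening_frontier.trans <|
    (Metric.thickening_mono (hδ.2.trans_le (min_le_right _ _)).le _).trans hthick
  rw [Set.inter_univ, ← Set.inter_eq_left.2 hlayer]
  exact hineq δ ⟨hδ.1, hδ.2.trans_le (min_le_left _ _)⟩ φ hφ

/-! ### Existence and uniqueness of traces -/

section WeakGradient

variable {Ω : Set (E n)} {u φ : E n → ℝ} {G G' : E n → E n}

theorem IsWeakGradient.inner_integral_smul (hG : IsWeakGradient Ω u G)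
    (hGloc : LocallyIntegrable G (volume.restrict Ω)) (hφ : IsTestFunction Ω φ) (v : E n) :
    ⟪v, ∫ x in Ω, φ x • G x⟫ = -∫ x in Ω, u x * fderiv ℝ φ x v := by
  have hint := hGloc.integrable_smul_left_of_hasCompactSupport hφ.1.continuous hφ.2.1
  rw [hG φ hφ, neg_neg, ← integral_inner hint]
  simp_rw [inner_smul_right, real_inner_comm, mul_comm]

theorem IsWeakGradient.ae_eq (hΩ : IsOpen Ω) (hG : IsWeakGradient Ω u G)
    (hGloc : LocallyIntegrable G (volume.restrict Ω)) (hG' : IsWeakGradient Ω u G')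
    (hGloc' : LocallyIntegrable G' (volume.restrict Ω)) : G =ᵐ[volume.restrict Ω] G' := by
  have hzero := hΩ.ae_eq_zero_of_integral_contDiff_smul_eq_zero
    (locallyIntegrableOn_of_locallyIntegrable_restrict (hGloc.sub hGloc')) fun φ hφ hcpt hsupp => by
      have htest : IsTestFunction Ω φ := ⟨hφ, hcpt, hsupp⟩
      calc ∫ x, φ x • (G - G') x = ∫ x in Ω, (φ x • G x - φ x • G' x) := by
            simp_rw [Pi.sub_apply, ← smul_sub]
            refine (setIntegral_eq_integral_of_forall_compl_eq_zero fun x hx => ?_).symm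
            rw [image_eq_zero_of_notMem_tsupport fun hx' => hx (hsupp hx'), zero_smul]
        _ = (∫ x in Ω, φ x • G x) - ∫ x in Ω, φ x • G' x :=
            integral_sub (hGloc.integrable_smul_left_of_hasCompactSupport hφ.continuous hcpt)
              (hGloc'.integrable_smul_left_of_hasCompactSupport hφ.continuous hcpt)
        _ = 0 := sub_eq_zero.2 <| ext_inner_left ℝ fun v => by
            rw [hG.inner_integral_smul hGloc htest, hG'.inner_integral_smul hGloc' htest]
  filter_upwards [(ae_restrict_iff' hΩ.measurableSet).2 hzero] with x hx using sub_eq_zero.1 hx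

end WeakGradient

theorem eLpNorm_sub_le_eLpNorm_sub_add {α F : Type*} [MeasurableSpace α] [NormedAddCommGroup F]
    {μ : Measure α} {p : ℝ≥0∞} (hp : 1 ≤ p) {f g w : α → F} (hf : AEStronglyMeasurable f μ)
    (hg : AEStronglyMeasurable g μ) (hw : AEStronglyMeasurable w μ) :
    eLpNorm (fun x => f x - g x) p μ ≤
      eLpNorm (fun x => f x - w x) p μ + eLpNorm (fun x => g x - w x) p μ := by
  refine le_of_eq_of_le ?_ (eLpNorm_sub_le (hf.sub hw) (hg.sub hw) hp)
  congr 1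
  ext x
  simp

theorem tendsto_eLpNorm_sub_of_tendstoUniformlyOn {α ι F : Type*} [MeasurableSpace α]
    [NormedAddCommGroup F] {μ : Measure α} [IsFiniteMeasure μ] {s : Set α}
    (hs : ∀ᵐ x ∂μ, x ∈ s) {l : Filter ι} {f : ι → α → F} {g : α → F}
    (hfg : TendstoUniformlyOn f g l s) (p : ℝ≥0∞) :
    Tendsto (fun i => eLpNorm (fun x => f i x - g x) p μ) l (𝓝 0) := by
  set A := μ Set.univ ^ p.toReal⁻¹
  have hA : A ≠ ⊤ := ENNReal.rpow_ne_top_of_nonneg (by positivity) (measure_ne_top _ _)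
  have hbound : Tendsto (fun ε : ℝ => A * ENNReal.ofReal ε) (𝓝[>] 0) (𝓝 0) := by
    have := ENNReal.Tendsto.const_mul (a := A)
      (ENNReal.tendsto_ofReal (tendsto_id (α := ℝ) (x := 𝓝 0))) (.inr hA)
    simp only [id, ENNReal.ofReal_zero, mul_zero] at this
    exact this.mono_left nhdsWithin_le_nhds
  refine ENNReal.tendsto_nhds_zero.2 fun η hη => ?_
  obtain ⟨ε, hεη, hε⟩ := ((ENNReal.tendsto_nhds_zero.1 hbound η hη).and
    self_mem_nhdsWithin).exists
  filter_upwards [Metric.tendstoUniformlyOn_iff.1 hfg ε hε] with i hi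
  refine (eLpNorm_le_of_ae_bound (hs.mono fun x hx => ?_)).trans hεη
  rw [← dist_eq_norm, dist_comm]
  exact (hi x hx).le

namespace IsLipschitzDomain

variable {Ω : Set (E n)} {p : ℝ≥0∞} {u : E n → ℝ}

theorem exists_eLpNorm_surfaceMeasure_le (hΩ : IsLipschitzDomain Ω) (hp : 1 ≤ p) (hp' : p ≠ ⊤) :
    ∃ C : ℝ≥0, ∀ φ : E n → ℝ, ContDiff ℝ 1 φ → eLpNorm φ p (surfaceMeasure Ω) ≤
      C * (eLpNorm φ p (volume.restrict Ω) + eLpNorm (gradient φ) p (volume.restrict Ω)) := by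
  obtain ⟨C, hC⟩ := hΩ.hasTraceInequalityOn
  have hp0 : p ≠ 0 := (zero_lt_one.trans_le hp).ne'
  have hp1 : 1 ≤ p.toReal := by simpa using ENNReal.toReal_mono hp' hp
  have hinv : 0 ≤ 1 / p.toReal := by positivity
  refine ⟨C ^ (1 / p.toReal), fun φ hφ => ?_⟩
  have hpow : ∫⁻ y, ‖φ y‖ₑ ^ p.toReal ∂surfaceMeasure Ω ≤
      C * ∫⁻ x in Ω, (‖φ x‖ₑ + ‖gradient φ x‖ₑ) ^ p.toReal := by
    simpa only [surfaceMeasure, Measure.restrict_restrict measurableSet_frontier, Set.inter_self]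
      using hC _ hp1 φ hφ
  calc eLpNorm φ p (surfaceMeasure Ω)
      ≤ (C : ℝ≥0∞) ^ (1 / p.toReal) *
          eLpNorm (fun x => ‖φ x‖ₑ + ‖gradient φ x‖ₑ) p (volume.restrict Ω) := by
        rw [eLpNorm_eq_lintegral_rpow_enorm_toReal hp0 hp',
          eLpNorm_eq_lintegral_rpow_enorm_toReal hp0 hp', ← ENNReal.mul_rpow_of_nonneg _ _ hinv]
        simp only [enorm_eq_self]
        gcongr
    _ ≤ _ := by
        rw [ENNReal.coe_rpow_of_nonneg _ hinv]
        gcongr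
        refine (eLpNorm_add_le hφ.continuous.enorm.aestronglyMeasurable
          (continuous_gradient hφ).enorm.aestronglyMeasurable hp).trans_eq ?_
        rw [eLpNorm_enorm, eLpNorm_enorm]

theorem isFiniteMeasure_surfaceMeasure (hΩ : IsLipschitzDomain Ω) :
    IsFiniteMeasure (surfaceMeasure Ω) := by
  obtain ⟨C, hC⟩ := hΩ.exists_eLpNorm_surfaceMeasure_le le_rfl ENNReal.one_ne_top
  have hone := hC (fun _ => 1) contDiff_const
  rw [gradient_fun_const', eLpNorm_zero', add_zero, eLpNorm_one_eq_lintegral_enorm,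
    eLpNorm_one_eq_lintegral_enorm, enorm_one, lintegral_one, lintegral_one,
    Measure.restrict_apply_univ] at hone
  exact ⟨hone.trans_lt (ENNReal.mul_lt_top ENNReal.coe_lt_top hΩ.2.1.measure_lt_top)⟩

theorem memLp_surfaceMeasure (hΩ : IsLipschitzDomain Ω) {f : E n → ℝ}
    (hf : ContinuousOn f (frontier Ω)) (p : ℝ≥0∞) : MemLp f p (surfaceMeasure Ω) := by
  have := hΩ.isFiniteMeasure_surfaceMeasure
  obtain ⟨C, hC⟩ := hΩ.isCompact_frontier.exists_bound_of_continuousOn hf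
  exact .of_bound (hf.aestronglyMeasurable measurableSet_frontier) C
    (ae_restrict_of_forall_mem measurableSet_frontier hC)

theorem tendsto_eLpNorm_surfaceMeasure_sub (hΩ : IsLipschitzDomain Ω) (hp : 1 ≤ p) (hp' : p ≠ ⊤)
    {φ ψ : ℕ → E n → ℝ} (hφ : SmoothTendstoW1 Ω p φ u) (hψ : SmoothTendstoW1 Ω p ψ u) :
    Tendsto (fun i : ℕ × ℕ => eLpNorm (fun x => φ i.1 x - ψ i.2 x) p (surfaceMeasure Ω))
      (atTop ×ˢ atTop) (𝓝 0) := by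
  obtain ⟨C, hC⟩ := hΩ.exists_eLpNorm_surfaceMeasure_le hp hp'
  obtain ⟨hφs, hup, G, hGp, hG, hφu, hφG⟩ := hφ
  obtain ⟨hψs, -, G', hGp', hG', hψu, hψG'⟩ := hψ
  have hψG : Tendsto (fun k => eLpNorm (fun x => gradient (ψ k) x - G x) p (volume.restrict Ω))
      atTop (𝓝 0) := by
    refine hψG'.congr fun k => eLpNorm_congr_ae ?_
    filter_upwards [hG'.ae_eq hΩ.1 (hGp'.locallyIntegrable hp) hG (hGp.locallyIntegrable hp)]
      with x hx
    rw [hx]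
  have hlim := ENNReal.Tendsto.const_mul (a := (C : ℝ≥0∞))
    (((hφu.comp tendsto_fst).add (hψu.comp tendsto_snd)).add
      ((hφG.comp tendsto_fst).add (hψG.comp tendsto_snd))) (.inr ENNReal.coe_ne_top)
  simp only [add_zero, mul_zero] at hlim
  refine tendsto_of_tendsto_of_tendsto_of_le_of_le tendsto_const_nhds hlim
    (fun _ => zero_le) fun i => ?_
  have hφ1 : ContDiff ℝ 1 (φ i.1) := (hφs i.1).of_le (by norm_cast)
  have hψ1 : ContDiff ℝ 1 (ψ i.2) := (hψs i.2).of_le (by norm_cast)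
  have hgrad : gradient (fun x => φ i.1 x - ψ i.2 x) =
      fun x => gradient (φ i.1) x - gradient (ψ i.2) x := funext fun x =>
    gradient_sub (hφ1.differentiable one_ne_zero x) (hψ1.differentiable one_ne_zero x)
  refine (hC _ (hφ1.sub hψ1)).trans ?_
  rw [hgrad]
  simp only [Function.comp_apply]
  gcongr
  · exact eLpNorm_sub_le_eLpNorm_sub_add hp hφ1.continuous.aestronglyMeasurable
      hψ1.continuous.aestronglyMeasurable hup.1
  · exact eLpNorm_sub_le_eLpNorm_sub_add hp (continuous_gradient hφ1).aestronglyMeasurable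
      (continuous_gradient hψ1).aestronglyMeasurable hGp.1

theorem exists_smoothTendstoW1 (hΩ : IsLipschitzDomain Ω) (hp : 1 ≤ p) (hp' : p ≠ ⊤)
    (hu : MemW1 Ω p u) : ∃ φ, SmoothTendstoW1 Ω p φ u ∧
      (ContinuousOn u (closure Ω) → TendstoUniformlyOn φ u atTop (closure Ω)) := by
  obtain ⟨hup, G, hGp, hG⟩ := hu
  obtain ⟨φ, hφ, hunif⟩ := hΩ.exists_smooth_approx hp hp' hup hGp hG
  exact ⟨φ, ⟨hφ.contDiff, hup, G, hGp, hG, hφ.tendsto, hφ.tendsto_gradient⟩, hunif⟩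

theorem exists_isTrace (hΩ : IsLipschitzDomain Ω) (hp : 1 ≤ p) (hp' : p ≠ ⊤) (hu : MemW1 Ω p u) :
    ∃ g, IsTrace Ω p u g := by
  have : Fact (1 ≤ p) := ⟨hp⟩
  obtain ⟨φ, hφ, -⟩ := hΩ.exists_smoothTendstoW1 hp hp' hu
  have hmem (k : ℕ) : MemLp (φ k) p (surfaceMeasure Ω) :=
    hΩ.memLp_surfaceMeasure (hφ.1 k).continuous.continuousOn p
  have hcauchy : CauchySeq fun k => (hmem k).toLp (φ k) := by
    rw [Lp.cauchySeq_Lp_iff_cauchySeq_eLpNorm, ← prod_atTop_atTop_eq]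
    refine (hΩ.tendsto_eLpNorm_surfaceMeasure_sub hp hp' hφ hφ).congr fun i =>
      eLpNorm_congr_ae ?_
    exact ((hmem i.1).coeFn_toLp.sub (hmem i.2).coeFn_toLp).symm
  obtain ⟨g, hg⟩ := cauchySeq_tendsto_of_complete hcauchy
  refine ⟨g, Lp.memLp g, φ, hφ, ?_⟩
  refine ((Lp.tendsto_Lp_iff_tendsto_eLpNorm' _ g).1 hg).congr fun k => eLpNorm_congr_ae ?_
  exact (hmem k).coeFn_toLp.sub .rfl

theorem isTrace_ae_eq (hΩ : IsLipschitzDomain Ω) (hp : 1 ≤ p) (hp' : p ≠ ⊤) {g g' : E n → ℝ}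
    (hg : IsTrace Ω p u g) (hg' : IsTrace Ω p u g') : g' =ᵐ[surfaceMeasure Ω] g := by
  obtain ⟨hgp, φ, hφ, hφg⟩ := hg
  obtain ⟨hgp', ψ, hψ, hψg'⟩ := hg'
  have hdiag : Tendsto (fun k : ℕ => (k, k)) atTop (atTop ×ˢ atTop) :=
    tendsto_id.prodMk tendsto_id
  have hψφ := (hΩ.tendsto_eLpNorm_surfaceMeasure_sub hp hp' hψ hφ).comp hdiag
  have hgφ : Tendsto (fun k => eLpNorm (g - φ k) p (surfaceMeasure Ω)) atTop (𝓝 0) :=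
    hφg.congr fun k => eLpNorm_sub_comm (φ k) g p _
  have hgψ : Tendsto (fun k => eLpNorm (g' - ψ k) p (surfaceMeasure Ω)) atTop (𝓝 0) :=
    hψg'.congr fun k => eLpNorm_sub_comm (ψ k) g' p _
  have hlim := hgψ.add (hgφ.add hψφ)
  rw [add_zero, add_zero] at hlim
  have hzero : eLpNorm (g' - g) p (surfaceMeasure Ω) = 0 := by
    refine le_antisymm (ge_of_tendsto' hlim fun k => ?_) zero_le
    have hψm := (hψ.1 k).continuous.aestronglyMeasurable (μ := surfaceMeasure Ω)
    have hφm := (hφ.1 k).continuous.aestronglyMeasurable (μ := surfaceMeasure Ω)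
    exact (eLpNorm_sub_le_eLpNorm_sub_add hp hgp'.1 hgp.1 hψm).trans
      (add_le_add_right (eLpNorm_sub_le_eLpNorm_sub_add hp hgp.1 hψm hφm) _)
  have hae := (eLpNorm_eq_zero_iff (hgp'.1.sub hgp.1) (zero_lt_one.trans_le hp).ne').1 hzero
  filter_upwards [hae] with x hx using sub_eq_zero.1 hx

theorem isTrace_self (hΩ : IsLipschitzDomain Ω) (hp : 1 ≤ p) (hp' : p ≠ ⊤) (hu : MemW1 Ω p u)
    (hc : ContinuousOn u (closure Ω)) : IsTrace Ω p u u := by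
  obtain ⟨φ, hφ, hunif⟩ := hΩ.exists_smoothTendstoW1 hp hp' hu
  have := hΩ.isFiniteMeasure_surfaceMeasure
  refine ⟨hΩ.memLp_surfaceMeasure (hc.mono frontier_subset_closure) p, φ, hφ, ?_⟩
  exact tendsto_eLpNorm_sub_of_tendstoUniformlyOn (μ := surfaceMeasure Ω)
    (ae_restrict_mem measurableSet_frontier)
    ((hunif hc).mono frontier_subset_closure) p

end IsLipschitzDomain

/-! ### Functions with zero trace -/

theorem MemW1Zero.isTrace_zero {Ω : Set (E n)} (hΩ : IsOpen Ω) {p : ℝ≥0∞} {u : E n → ℝ}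
    (hu : MemW1Zero Ω p u) : MemW1 Ω p u ∧ IsTrace Ω p u 0 := by
  obtain ⟨φ, hφ, hlim⟩ := hu
  refine ⟨?_, MemLp.zero, φ, hlim, tendsto_const_nhds.congr fun k => ?_⟩
  · obtain ⟨-, hup, G, hGp, hG, -⟩ := hlim
    exact ⟨hup, G, hGp, hG⟩
  · rw [eLpNorm_congr_ae (g := 0), eLpNorm_zero]
    refine ae_restrict_of_forall_mem measurableSet_frontier fun x hx => ?_
    rw [hΩ.frontier_eq] at hx
    simp [image_eq_zero_of_notMem_tsupport fun h => hx.2 ((hφ k).2.2 h)]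

theorem IsTestFunction.mul_right {Ω : Set (E n)} {χ φ : E n → ℝ} (hχ : IsTestFunction Ω χ)
    (hφ : ContDiff ℝ ∞ φ) : IsTestFunction Ω fun x => χ x * φ x :=
  ⟨hχ.1.mul hφ, hχ.2.1.mul_right, (tsupport_mul_subset_left (f := χ) (g := φ)).trans hχ.2.2⟩

/-- Smooth cutoff functions with compact support in `Ω` that are equal to `1` off the boundary layer
of width `δ`. -/
structure IsCutoff (Ω : Set (E n)) (δ : ℝ) (χ : E n → ℝ) : Prop where
  isTestFunction : IsTestFunction Ω χ
  mem_Icc : ∀ x, χ x ∈ Set.Icc 0 1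
  enorm_gradient_le : ∀ x, ‖gradient χ x‖ₑ ≤ ENNReal.ofReal (4 / δ)
  eq_one : ∀ x ∈ Ω \ boundaryLayer Ω δ, χ x = 1

theorem exists_isCutoff {Ω : Set (E n)} (hb : Bornology.IsBounded Ω) {δ : ℝ} (hδ : 0 < δ) :
    ∃ χ, IsCutoff Ω δ χ := by
  obtain ⟨χ, hχ, hχ01, hχ', hχ0, hχ1⟩ := exists_smooth_cutoff Ωᶜ hδ
  have hsupp : tsupport χ ⊆ (Metric.thickening (δ / 4) Ωᶜ)ᶜ :=
    closure_minimal (fun x hx hx' => hx (hχ0 x hx')) Metric.isOpen_thickening.isClosed_compl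
  have hsuppΩ : tsupport χ ⊆ Ω := hsupp.trans <|
    Set.compl_subset_comm.1 (Metric.self_subset_thickening (by positivity) _)
  refine ⟨χ, ⟨hχ, ?_, hsuppΩ⟩, hχ01, fun x => ?_, fun x hx => hχ1 x fun h => hx.2 ⟨hx.1, h⟩⟩
  · exact hb.isCompact_closure.of_isClosed_subset (isClosed_tsupport _)
      (hsuppΩ.trans subset_closure)
  · rw [enorm_gradient, ← ofReal_norm]
    exact ENNReal.ofReal_le_ofReal (hχ' x)

section Lintegral

variable {α F : Type*} [MeasurableSpace α] [NormedAddCommGroup F] {μ : Measure α} {s t : Set α}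
  {f g : α → F}

theorem setLIntegral_enorm_le_add (hts : t ⊆ s)
    (hfg : AEStronglyMeasurable (fun x => f x - g x) (μ.restrict s)) :
    ∫⁻ x in t, ‖f x‖ₑ ∂μ ≤ ∫⁻ x in s, ‖f x - g x‖ₑ ∂μ + ∫⁻ x in t, ‖g x‖ₑ ∂μ := by
  calc ∫⁻ x in t, ‖f x‖ₑ ∂μ ≤ ∫⁻ x in t, (‖f x - g x‖ₑ + ‖g x‖ₑ) ∂μ :=
        lintegral_mono fun x => by simpa using enorm_add_le (f x - g x) (g x)
    _ = ∫⁻ x in t, ‖f x - g x‖ₑ ∂μ + ∫⁻ x in t, ‖g x‖ₑ ∂μ :=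
        lintegral_add_left' (hfg.mono_measure (Measure.restrict_mono_set μ hts)).enorm _
    _ ≤ _ := by gcongr

theorem setLIntegral_enorm_smul_sub_le [NormedSpace ℝ F] (hs : MeasurableSet s)
    (ht : MeasurableSet t) {χ : α → ℝ} (hχ : ∀ x, χ x ∈ Set.Icc 0 1) (hχ1 : ∀ x ∈ s \ t, χ x = 1)
    (hfg : AEStronglyMeasurable (fun x => f x - g x) (μ.restrict s)) :
    ∫⁻ x in s, ‖χ x • f x - g x‖ₑ ∂μ ≤
      ∫⁻ x in s, ‖f x - g x‖ₑ ∂μ + ∫⁻ x in t, ‖g x‖ₑ ∂μ := by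
  have hpoint : ∀ x ∈ s, ‖χ x • f x - g x‖ₑ ≤ ‖f x - g x‖ₑ + t.indicator (‖g ·‖ₑ) x := by
    intro x hx
    by_cases hxt : x ∈ t
    · have hle : ‖χ x‖ₑ ≤ 1 := by
        rw [Real.enorm_of_nonneg (hχ x).1]
        exact ENNReal.ofReal_le_one.2 (hχ x).2
      have hle' : ‖χ x - 1‖ₑ ≤ 1 := by
        rw [← enorm_neg, neg_sub, Real.enorm_of_nonneg (sub_nonneg.2 (hχ x).2)]
        exact ENNReal.ofReal_le_one.2 (sub_le_self _ (hχ x).1)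
      calc ‖χ x • f x - g x‖ₑ = ‖χ x • (f x - g x) + (χ x - 1) • g x‖ₑ := by
            congr 1
            module
        _ ≤ ‖χ x‖ₑ * ‖f x - g x‖ₑ + ‖χ x - 1‖ₑ * ‖g x‖ₑ := by
            simpa only [enorm_smul] using enorm_add_le (χ x • (f x - g x)) ((χ x - 1) • g x)
        _ ≤ ‖f x - g x‖ₑ + t.indicator (‖g ·‖ₑ) x := by
            rw [Set.indicator_of_mem hxt]
            exact add_le_add (mul_le_of_le_one_left' hle) (mul_le_of_le_one_left' hle')
    · rw [hχ1 x ⟨hx, hxt⟩, one_smul]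
      exact le_self_add
  calc ∫⁻ x in s, ‖χ x • f x - g x‖ₑ ∂μ
      ≤ ∫⁻ x in s, (‖f x - g x‖ₑ + t.indicator (‖g ·‖ₑ) x) ∂μ := setLIntegral_mono' hs hpoint
    _ = ∫⁻ x in s, ‖f x - g x‖ₑ ∂μ + ∫⁻ x in t ∩ s, ‖g x‖ₑ ∂μ := by
        rw [lintegral_add_left' hfg.enorm, setLIntegral_indicator ht]
    _ ≤ _ := by
        gcongr
        exact Set.inter_subset_left

end Lintegral

namespace IsCutoff

variable {Ω : Set (E n)} {δ : ℝ} {χ φ : E n → ℝ}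

theorem gradient_eq_zero (hχ : IsCutoff Ω δ χ) {x : E n} (hx : x ∈ Ω \ boundaryLayer Ω δ) :
    gradient χ x = 0 := by
  have hmax : IsLocalMax χ x := .of_forall fun y => (hχ.mem_Icc y).2.trans (hχ.eq_one x hx).ge
  rw [gradient, hmax.fderiv_eq_zero, map_zero]

theorem lintegral_enorm_smul_gradient_le (hχ : IsCutoff Ω δ χ) (hΩ : IsOpen Ω) (φ : E n → ℝ) :
    ∫⁻ x in Ω, ‖φ x • gradient χ x‖ₑ ≤
      ENNReal.ofReal (4 / δ) * ∫⁻ x in boundaryLayer Ω δ, ‖φ x‖ₑ := by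
  have hlayer := (isOpen_boundaryLayer hΩ δ).measurableSet
  have hpoint : ∀ x ∈ Ω, ‖φ x • gradient χ x‖ₑ ≤
      (boundaryLayer Ω δ).indicator (fun x => ENNReal.ofReal (4 / δ) * ‖φ x‖ₑ) x := by
    intro x hx
    by_cases hxl : x ∈ boundaryLayer Ω δ
    · rw [Set.indicator_of_mem hxl, enorm_smul, mul_comm]
      gcongr
      exact hχ.enorm_gradient_le x
    · rw [hχ.gradient_eq_zero ⟨hx, hxl⟩, smul_zero, enorm_zero]
      exact zero_le
  calc ∫⁻ x in Ω, ‖φ x • gradient χ x‖ₑ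
      ≤ ∫⁻ x in Ω, (boundaryLayer Ω δ).indicator (fun x => ENNReal.ofReal (4 / δ) * ‖φ x‖ₑ) x :=
        setLIntegral_mono' hΩ.measurableSet hpoint
    _ = _ := by
        rw [setLIntegral_indicator hlayer, Set.inter_eq_left.2 boundaryLayer_subset,
          lintegral_const_mul' _ _ ENNReal.ofReal_ne_top]

theorem lintegral_enorm_gradient_mul_sub_le (hχ : IsCutoff Ω δ χ) (hΩ : IsOpen Ω)
    (hφ : ContDiff ℝ 1 φ) {G : E n → E n} (hG : AEStronglyMeasurable G (volume.restrict Ω)) :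
    ∫⁻ x in Ω, ‖gradient (fun y => χ y * φ y) x - G x‖ₑ ≤
      (∫⁻ x in Ω, ‖gradient φ x - G x‖ₑ) + (∫⁻ x in boundaryLayer Ω δ, ‖G x‖ₑ) +
        ENNReal.ofReal (4 / δ) * ∫⁻ x in boundaryLayer Ω δ, ‖φ x‖ₑ := by
  have hχ1 : ContDiff ℝ 1 χ := hχ.isTestFunction.1.of_le (by norm_cast)
  have hφm := (continuous_gradient hφ).aestronglyMeasurable (μ := volume.restrict Ω)
  have hprod (x : E n) : gradient (fun y => χ y * φ y) x - G x =
      χ x • gradient φ x - G x + φ x • gradient χ x := by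
    rw [gradient_mul (hχ1.differentiable one_ne_zero x) (hφ.differentiable one_ne_zero x)]
    abel
  calc ∫⁻ x in Ω, ‖gradient (fun y => χ y * φ y) x - G x‖ₑ
      ≤ ∫⁻ x in Ω, (‖χ x • gradient φ x - G x‖ₑ + ‖φ x • gradient χ x‖ₑ) :=
        lintegral_mono fun x => by
          rw [hprod]
          exact enorm_add_le _ _
    _ = (∫⁻ x in Ω, ‖χ x • gradient φ x - G x‖ₑ) + ∫⁻ x in Ω, ‖φ x • gradient χ x‖ₑ :=
        lintegral_add_left' ((hχ1.continuous.aestronglyMeasurable.smul hφm).sub hG).enorm _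
    _ ≤ _ := add_le_add
        (setLIntegral_enorm_smul_sub_le hΩ.measurableSet
          (isOpen_boundaryLayer hΩ δ).measurableSet hχ.mem_Icc hχ.eq_one (hφm.sub hG))
        (hχ.lintegral_enorm_smul_gradient_le hΩ φ)

end IsCutoff

theorem IsLipschitzDomain.exists_lintegral_boundaryLayer_le {Ω : Set (E n)}
    (hΩ : IsLipschitzDomain Ω) :
    ∃ (C M : ℝ≥0) (δ₀ : ℝ), 0 < δ₀ ∧ ∀ δ ∈ Set.Ioo 0 δ₀, ∀ φ : E n → ℝ, ContDiff ℝ 1 φ →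
      ∀ G : E n → E n, AEStronglyMeasurable G (volume.restrict Ω) →
        ENNReal.ofReal (4 / δ) * ∫⁻ x in boundaryLayer Ω δ, ‖φ x‖ₑ ≤
          C * (∫⁻ y, ‖φ y‖ₑ ∂surfaceMeasure Ω + ((∫⁻ x in Ω, ‖gradient φ x - G x‖ₑ) +
            ∫⁻ x in boundaryLayer Ω (M * δ), ‖G x‖ₑ)) := by
  obtain ⟨C, M, δ₀, hδ₀, hineq⟩ := hΩ.hasLayerInequalityOn_univ
  refine ⟨4 * C, M, δ₀, hδ₀, fun δ hδ φ hφ G hG => ?_⟩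
  have hfour : ENNReal.ofReal (4 / δ) * ENNReal.ofReal δ = 4 := by
    rw [← ENNReal.ofReal_mul (div_pos four_pos hδ.1).le, div_mul_cancel₀ _ hδ.1.ne',
      ENNReal.ofReal_ofNat]
  calc ENNReal.ofReal (4 / δ) * ∫⁻ x in boundaryLayer Ω δ, ‖φ x‖ₑ
      ≤ ENNReal.ofReal (4 / δ) * (C * ENNReal.ofReal δ * (∫⁻ y, ‖φ y‖ₑ ∂surfaceMeasure Ω +
          ∫⁻ x in boundaryLayer Ω (M * δ), ‖gradient φ x‖ₑ)) := by
        gcongr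
        simpa only [Set.inter_univ] using hineq δ hδ φ hφ
    _ = (4 * C : ℝ≥0) * (∫⁻ y, ‖φ y‖ₑ ∂surfaceMeasure Ω +
          ∫⁻ x in boundaryLayer Ω (M * δ), ‖gradient φ x‖ₑ) := by
        rw [← mul_assoc, mul_left_comm, hfour, mul_comm (C : ℝ≥0∞), ENNReal.coe_mul,
          ENNReal.coe_ofNat]
    _ ≤ _ := by
        gcongr
        exact setLIntegral_enorm_le_add boundaryLayer_subset
          ((continuous_gradient hφ).aestronglyMeasurable.sub hG)

theorem IsLipschitzDomain.memW1Zero_of_isTrace_zero {Ω : Set (E n)} (hΩ : IsLipschitzDomain Ω)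
    {u : E n → ℝ} (hu : IsTrace Ω 1 u 0) : MemW1Zero Ω 1 u := by
  obtain ⟨-, φ, ⟨hφs, hup, G, hGp, hG, hφu, hφG⟩, hφ0⟩ := hu
  obtain ⟨C, M, δ₀, hδ₀, hineq⟩ := hΩ.exists_lintegral_boundaryLayer_le
  obtain ⟨δ, -, hδ, hδlim⟩ := exists_seq_strictAnti_tendsto' hδ₀
  choose χ hχ using fun m => exists_isCutoff hΩ.2.1 (hδ m).1
  have hφ1 (m : ℕ) : ContDiff ℝ 1 (φ m) := (hφs m).of_le (by norm_cast)
  have hlayer {F : Type} [NormedAddCommGroup F] {f : E n → F} (hf : MemLp f 1 (volume.restrict Ω))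
      {r : ℕ → ℝ} (hr : Tendsto r atTop (𝓝 0)) :
      Tendsto (fun m => ∫⁻ x in boundaryLayer Ω (r m), ‖f x‖ₑ) atTop (𝓝 0) := by
    have hfin := hf.2.ne
    rw [eLpNorm_one_eq_lintegral_enorm] at hfin
    exact (tendsto_setLIntegral_boundaryLayer hΩ.1 hfin).comp hr
  have hMδ : Tendsto (fun m => M * δ m) atTop (𝓝 0) := by simpa using hδlim.const_mul (M : ℝ)
  simp only [eLpNorm_one_eq_lintegral_enorm, Pi.zero_apply, sub_zero] at hφu hφG hφ0
  refine ⟨fun m x => χ m x * φ m x, fun m => (hχ m).isTestFunction.mul_right (hφs m),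
    fun m => (hχ m).isTestFunction.1.mul (hφs m), hup, G, hGp, hG, ?_, ?_⟩
  all_goals simp only [eLpNorm_one_eq_lintegral_enorm]
  · have hlim := hφu.add (hlayer hup hδlim)
    rw [add_zero] at hlim
    refine tendsto_of_tendsto_of_tendsto_of_le_of_le tendsto_const_nhds hlim
      (fun _ => zero_le) fun m => ?_
    exact setLIntegral_enorm_smul_sub_le hΩ.1.measurableSet
      (isOpen_boundaryLayer hΩ.1 _).measurableSet (hχ m).mem_Icc (hχ m).eq_one
      ((hφ1 m).continuous.aestronglyMeasurable.sub hup.1)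
  · have hlim := (hφG.add (hlayer hGp hδlim)).add <| ENNReal.Tendsto.const_mul (a := (C : ℝ≥0∞))
      (hφ0.add (hφG.add (hlayer hGp hMδ))) (.inr ENNReal.coe_ne_top)
    simp only [add_zero, mul_zero] at hlim
    refine tendsto_of_tendsto_of_tendsto_of_le_of_le tendsto_const_nhds hlim
      (fun _ => zero_le) fun m => ?_
    exact ((hχ m).lintegral_enorm_gradient_mul_sub_le hΩ.1 (hφ1 m) hGp.1).trans
      (add_le_add_right (hineq _ (hδ m) _ (hφ1 m) _ hGp.1) _)

end SobolevTrace

theorem mainTheorem9 (n : ℕ) (hn : 1 ≤ n) (Ω : Set (SobolevTrace.E n))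
    (hΩ : SobolevTrace.IsLipschitzDomain Ω) :
    -- the trace is well defined on `W^{1,p}(Ω)`, and it is `u` for `u ∈ C⁰(closure Ω)`
    (∀ p : ℝ≥0∞, 1 ≤ p → p ≠ ⊤ →
      (∀ u : SobolevTrace.E n → ℝ, SobolevTrace.MemW1 Ω p u →
        ∃ g : SobolevTrace.E n → ℝ, SobolevTrace.IsTrace Ω p u g ∧
          ∀ g' : SobolevTrace.E n → ℝ, SobolevTrace.IsTrace Ω p u g' →
            g' =ᵐ[SobolevTrace.surfaceMeasure Ω] g) ∧
      (∀ u : SobolevTrace.E n → ℝ, SobolevTrace.MemW1 Ω p u → ContinuousOn u (closure Ω) →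
        SobolevTrace.IsTrace Ω p u u)) ∧
    -- `W^{1,1}_0(Ω) = {u ∈ W^{1,1}(Ω) : tr u = 0}`
    {u : SobolevTrace.E n → ℝ | SobolevTrace.MemW1Zero Ω 1 u} =
      {u : SobolevTrace.E n → ℝ | SobolevTrace.MemW1 Ω 1 u ∧ SobolevTrace.IsTrace Ω 1 u 0} := by
  refine ⟨fun p hp hp' => ⟨fun u hu => ?_, fun u hu hc => hΩ.isTrace_self hp hp' hu hc⟩, ?_⟩
  · obtain ⟨g, hg⟩ := hΩ.exists_isTrace hp hp' hu
    exact ⟨g, hg, fun g' hg' => hΩ.isTrace_ae_eq hp hp' hg hg'⟩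
  · ext u
    exact ⟨fun hu => hu.isTrace_zero hΩ.1, fun hu => hΩ.memW1Zero_of_isTrace_zero hu.2⟩
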